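/- Let $n\ge 0$ be an integer, let $\epsilon>0$ be real, let $a\in\mathbb{C}$ with $\mathrm{Re}(a/\epsilon)>-1$, and put $x=n\epsilon$, $\alpha=a/\epsilon$. Let $\mathcal{H}_n^+$ be the space of positive definite Hermitian $n\times n$ matrices with the measure $dM=\prod_{i}dM_{ii}\prod_{i<j}d\mathrm{Re}M_{ij}\,d\mathrm{Im}M_{ij}$, let $G$ be the Barnes $G$-function, let $\mathbf{p}=(p_1,p_2,\dots)$ be indeterminates, and let $V(M;\mathbf{p})=M-\sum_{j\ge1}\frac{p_j}{j}M^j$. Define the normalized LUE partition function as the formal power series in $\mathbf{p}$ $$Z_{\rm LUE1}(x,\mathbf{p};a;\epsilon)=\frac{G(\alpha+1)\,\epsilon^{-n^2-\alpha n}}{\pi^{n(n-1)/2}\,G(n+\alpha+1)}\int_{\mathcal{H}_n^+}(\det M)^{\alpha}\,e^{-\frac1\epsilon\mathrm{tr}\,V(M;\mathbf{p})}\,dM,$$ where the integrand is first Taylor expanded in $\mathbf{p}$ and the coefficient of each monomial is then integrated. Then all these integrals converge absolutely, and $$Z_{\rm LUE1}(x,\mathbf{p};a;\epsilon)=e^{W_{\rm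 Laguerre}}\,1=\sum_{k\ge0}\frac1{k!}W_{\rm Laguerre}^k\,1,$$ the sum converging coefficientwise in $\mathbb{C}[[\mathbf{p}]]$, where $W_{\rm Laguerre}$ is the cut-and-join type linear operator $$W_{\rm Laguerre}=(2x+a)\Lambda_1+M_1+\frac{x(x+a)}{\epsilon^2}p_1,\qquad \Lambda_1=\sum_{i\ge2}(i-1)\,p_i\frac{\partial}{\partial p_{i-1}},$$ $$M_1=\sum_{i\ge2}\sum_{j=1}^{i-1}\Bigl((i-1)\,p_jp_{i-j}\frac{\partial}{\partial p_{i-1}}+\epsilon^2 j(i-j)\,p_{i+1}\frac{\partial^2}{\partial p_j\partial p_{i-j}}\Bigr).$$ -/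

import Mathlib

open scoped Nat MvPowerSeries.WithPiTopology

noncomputable section

namespace LUE

/-- Formal power series over `ℂ` in the variables `p₁, p₂, p₃, …`. -/
abbrev PSeries : Type := MvPowerSeries ℕ+ ℂ

/-! ### Cut-and-join type operators on power series -/

/-- The operator `f ↦ p_k f`. -/
def mulP (k : ℕ+) : Module.End ℂ PSeries := LinearMap.mulLeft ℂ (MvPowerSeries.X k)

/-- The operator `f ↦ ∂f/∂p_k`. -/
def dP (k : ℕ+) : Module.End ℂ PSeries := (MvPowerSeries.pderiv ℂ k).toLinearMap

/-- A family of operators is locally finite if each coefficient of the output receives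
contributions from finitely many members only. -/
def LocallyFiniteOps {ι : Type} (T : ι → Module.End ℂ PSeries) : Prop :=
  ∀ μ : ℕ+ →₀ ℕ, {i | ∃ f, MvPowerSeries.coeff μ (T i f) ≠ 0}.Finite

theorem LocallyFiniteOps.finite_support {ι : Type} {T : ι → Module.End ℂ PSeries}
    (hT : LocallyFiniteOps T) (μ : ℕ+ →₀ ℕ) (f : PSeries) :
    (Function.support fun i => MvPowerSeries.coeff μ (T i f)).Finite :=
  (hT μ).subset fun _ hi => ⟨f, hi⟩

/-- The infinite sum `∑ i, T i` of a locally finite family of operators. -/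
def opSum {ι : Type} (T : ι → Module.End ℂ PSeries) (hT : LocallyFiniteOps T) :
    Module.End ℂ PSeries where
  toFun f := fun μ => ∑ᶠ i, MvPowerSeries.coeff μ (T i f)
  map_add' f g := by
    funext μ
    simp only [map_add]
    exact finsum_add_distrib (hT.finite_support μ f) (hT.finite_support μ g)
  map_smul' c f := by
    funext μ
    simp only [map_smul]
    exact (smul_finsum c _).symm

theorem coeff_X_mul_eq_zero {k : ℕ+} {μ : ℕ+ →₀ ℕ} (h : μ k = 0) (f : PSeries) :
    MvPowerSeries.coeff μ (MvPowerSeries.X k * f) = 0 :=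
  MvPowerSeries.X_dvd_iff.mp (dvd_mul_right _ f) μ h

/-- The `k`-th term `k p_{k+1} ∂/∂p_k` of `Λ₁`. -/
def lambdaTerm (k : ℕ+) : Module.End ℂ PSeries := (k : ℂ) • (mulP (k + 1) * dP k)

theorem lambdaTerm_locallyFinite : LocallyFiniteOps lambdaTerm := by
  intro μ
  refine ((μ.support.finite_toSet).preimage
    (f := fun k : ℕ+ => k + 1) (fun a _ b _ h => by simpa using h)).subset ?_
  rintro k ⟨f, hf⟩
  simp only [Set.mem_preimage, Finset.mem_coe, Finsupp.mem_support_iff]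
  intro h0
  exact hf (by simp [lambdaTerm, mulP, coeff_X_mul_eq_zero h0])

/-- `Λ₁ = ∑_{i ≥ 2} (i - 1) p_i ∂/∂p_{i-1}`, written with `k = i - 1`. -/
def Lambda1 : Module.End ℂ PSeries := opSum lambdaTerm lambdaTerm_locallyFinite

/-- The cut term `(i - 1) p_j p_{i-j} ∂/∂p_{i-1}` of `M₁`, where the index is the pair
`q = (j, i - j)`. -/
def cutTerm (q : ℕ+ × ℕ+) : Module.End ℂ PSeries :=
  (((q.1 + q.2 - 1 : ℕ+) : ℕ) : ℂ) • (mulP q.1 * mulP q.2 * dP (q.1 + q.2 - 1))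

/-- The join term `j (i - j) p_{i+1} ∂²/∂p_j∂p_{i-j}` of `M₁`, where the index is the pair
`q = (j, i - j)`. -/
def joinTerm (q : ℕ+ × ℕ+) : Module.End ℂ PSeries :=
  ((q.1 : ℂ) * (q.2 : ℂ)) • (mulP (q.1 + q.2 + 1) * dP q.1 * dP q.2)

theorem cut_join_locallyFinite (c : ℂ) :
    LocallyFiniteOps fun q => cutTerm q + c • joinTerm q := by
  intro μ
  have h1 : {q : ℕ+ × ℕ+ | q.1 ∈ μ.support ∧ q.2 ∈ μ.support}.Finite :=
    (μ.support.finite_toSet.prod μ.support.finite_toSet).subset fun q hq => hq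
  have h2 : {q : ℕ+ × ℕ+ | q.1 + q.2 + 1 ∈ μ.support}.Finite := by
    have : (⋃ m ∈ μ.support, {q : ℕ+ × ℕ+ | q.1 ∈ Set.Iic m ∧ q.2 ∈ Set.Iic m}).Finite :=
      (μ.support.finite_toSet).biUnion fun m _ =>
        ((Set.finite_Iic m).prod (Set.finite_Iic m)).subset fun q hq => hq
    refine this.subset fun q hq => ?_
    simp only [Set.mem_iUnion, Set.mem_ofPred_eq, Set.mem_Iic]
    refine ⟨_, hq, ?_, ?_⟩ <;>
      · rw [← PNat.coe_le_coe]
        simp only [PNat.add_coe]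
        omega
  refine (h1.union h2).subset ?_
  rintro q ⟨f, hf⟩
  by_contra hq
  simp only [Set.mem_union, Set.mem_ofPred_eq, Finsupp.mem_support_iff, not_or, not_and_or,
    not_not] at hq
  obtain ⟨ha, hb⟩ := hq
  refine hf ?_
  have hcut : MvPowerSeries.coeff μ (cutTerm q f) = 0 := by
    rcases ha with h | h
    · simp [cutTerm, mulP, mul_assoc, coeff_X_mul_eq_zero h]
    · simp only [cutTerm, mulP, LinearMap.smul_apply, Module.End.mul_apply,
        LinearMap.mulLeft_apply, map_smul]
      rw [mul_left_comm, coeff_X_mul_eq_zero h, smul_zero]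
  have hjoin : MvPowerSeries.coeff μ (joinTerm q f) = 0 := by
    simp [joinTerm, mulP, mul_assoc, coeff_X_mul_eq_zero hb]
  simp [hcut, hjoin]

/-- `M₁ = ∑_{i ≥ 2} ∑_{j=1}^{i-1} ((i-1) p_j p_{i-j} ∂/∂p_{i-1}
+ ε² j (i-j) p_{i+1} ∂²/∂p_j∂p_{i-j})`; the double sum runs over all pairs `(j, i - j)` of
positive integers. -/
def M1 (ε : ℝ) : Module.End ℂ PSeries :=
  opSum (fun q => cutTerm q + ((ε : ℂ) ^ 2) • joinTerm q) (cut_join_locallyFinite _)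

/-- `W_Laguerre = (2x + a) Λ₁ + M₁ + (x (x + a) / ε²) p₁`. -/
def WLaguerre (x a : ℂ) (ε : ℝ) : Module.End ℂ PSeries :=
  (2 * x + a) • Lambda1 + M1 ε + (x * (x + a) / (ε : ℂ) ^ 2) • mulP 1

/-! ### The normalized LUE partition function -/

/-- The Barnes `G`-function, by its Weierstrass product
`G(1+w) = (2π)^{w/2} e^{-w(w+1)/2 - γw²/2} ∏_{k ≥ 1} (1+w/k)^k e^{-w+w²/(2k)}`. -/
def barnesG (z : ℂ) : ℂ :=
  let w := z - 1
  ((2 * Real.pi : ℝ) : ℂ) ^ (w / 2) *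
    Complex.exp (-(w * (w + 1)) / 2 - (Real.eulerMascheroniConstant : ℂ) * w ^ 2 / 2) *
    ∏' k : ℕ, (1 + w / ((k : ℂ) + 1)) ^ (k + 1) *
      Complex.exp (-w + w ^ 2 / (2 * ((k : ℂ) + 1)))

/-- Coordinates on the space of Hermitian `n × n` matrices: the real diagonal entries, and the
complex entries strictly above the diagonal. Its `volume` is
`dM = ∏ᵢ dMᵢᵢ ∏_{i<j} dRe Mᵢⱼ dIm Mᵢⱼ`. -/
abbrev HermCoord (n : ℕ) : Type :=
  (Fin n → ℝ) × ({q : Fin n × Fin n // q.1 < q.2} → ℂ)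

/-- The Hermitian matrix with given coordinates. -/
def hermOf {n : ℕ} (c : HermCoord n) : Matrix (Fin n) (Fin n) ℂ :=
  Matrix.of fun i j =>
    if h : i < j then c.2 ⟨(i, j), h⟩
    else if h : j < i then starRingEnd ℂ (c.2 ⟨(j, i), h⟩)
    else (c.1 i : ℂ)

theorem hermOf_isHermitian {n : ℕ} (c : HermCoord n) : (hermOf c).IsHermitian := by
  ext i j
  rcases lt_trichotomy i j with h | h | h
  · simp [hermOf, h, h.not_gt]
  · subst h; simp [hermOf]
  · simp [hermOf, h, h.not_gt]

open scoped ComplexOrder in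
/-- The cone of positive definite Hermitian matrices, in coordinates. -/
def posCone (n : ℕ) : Set (HermCoord n) := {c | (hermOf c).PosDef}

/-- The coefficient of `∏_j p_j ^ μ_j` in the Taylor expansion with respect to `p` of
`(det M)^α exp(-(1/ε) tr V(M;p))`, where `V(M;p) = M - ∑_{j ≥ 1} (p_j / j) M^j`:
since the second factor is `exp(-tr M / ε) ∏_j exp(p_j tr(M^j) / (jε))`, this is
`(det M)^α exp(-tr M / ε) ∏_j (tr(M^j) / (jε))^{μ_j} / μ_j!`. -/
def taylorCoeff {n : ℕ} (α : ℂ) (ε : ℝ) (μ : ℕ+ →₀ ℕ) (M : Matrix (Fin n) (Fin n) ℂ) : ℂ :=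
  M.det ^ α * Complex.exp (-M.trace / (ε : ℂ)) *
    μ.prod fun j m => ((M ^ (j : ℕ)).trace / ((j : ℂ) * (ε : ℂ))) ^ m / (m ! : ℂ)

/-- The normalized LUE partition function of size `n`, as a formal power series in `p`: the
integrand is expanded in `p` and each coefficient is integrated over positive Hermitian
matrices. -/
def partitionFunction (n : ℕ) (α : ℂ) (ε : ℝ) : PSeries := fun μ =>
  barnesG (α + 1) * (ε : ℂ) ^ (-(n : ℂ) ^ 2 - α * n) /
      ((Real.pi : ℂ) ^ (n * (n - 1) / 2) * barnesG (n + α + 1)) *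
    ∫ c in posCone n, taylorCoeff α ε μ (hermOf c)

end LUE

end

/-!
The proof runs through the Virasoro constraints for the Laguerre weight.

*Normalization.* Splitting off the first row `(d, b)` of a Hermitian matrix and replacing the
remaining block by its Schur complement is a measure preserving change of coordinates
(`measurePreserving_schurEquiv`) that turns the cone of size `n + 1` into `(0, ∞) × ℂⁿ` times the
cone of size `n`, and factors the weight `(det M)^α e^{-c tr M}` accordingly. The first row
contributes a Gaussian integral and a `Γ`-integral, so that induction on `n` gives integrability and
the value of the total mass as a product of values of `Γ` (`integral_laguerreWeight`). The functional
equation `G(z + 1) = Γ(z) G(z)`, obtained from the Weierstrass product by telescoping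
(`barnesG_add_one`), turns this product into the quotient of Barnes functions in the normalization;
hence the constant term of the partition function `Z` is `1` (`expect_one`). Each coefficient of the
expanded integrand is the weight times a polynomial in the entries of `M`, and an entry of a
positive definite matrix is bounded by its trace, so that half of the exponential factor absorbs the
polynomial (`Tame.integrableOn`).

*Loop equations.* The integral over the cone of the divergence of the vector field `M^{k+1}`, times
the weight and a coefficient of `exp (∑ p_j t_j)` with `t_j = tr M^j / (j ε)`, vanishes
(`integral_loopIntegrand`). As the weight may blow up at the boundary of the cone when
`Re α < 0`, the field is first multiplied by a function of `det M` that vanishes near the boundary.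
The contribution of its derivative disappears in the limit by dominated convergence, since the
divergence of `f(det M) M^{k+1}` involves `f'` only through the bounded quantity `d f'(d)`.

*Algebra.* Under the integral `∂/∂p_j` is multiplication by `t_j`. The loop equations therefore are
differential equations for `Z` (`virasoro_one`, `virasoro_succ`). Multiplied by `p_{k+1}` and summed
over `k ≥ 0` they combine to `E Z = W Z`, where `E = ∑ k p_k ∂/∂p_k` and `W` is the cut-and-join
operator (`wt_mul_coeff_eq_of_virasoro`). Since `W` raises the weight by one and `Z` has constant
term `1`, the part of `Z` of weight `k` is `W^k 1 / k!` (`hasSum_exp_WLaguerre`).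
-/

namespace LUE

/-! ### The grading by weight and the exponential of `W_Laguerre` -/

/-- The weight `∑ k, k μ_k` of the monomial `∏ p_k ^ μ_k`, as an integer. -/
noncomputable def wt : (ℕ+ →₀ ℕ) →+ ℤ := Finsupp.weight fun k : ℕ+ => ((k : ℕ) : ℤ)

theorem wt_single (k : ℕ+) (m : ℕ) : wt (Finsupp.single k m) = m * (k : ℕ) := by
  simp [wt, Finsupp.weight_apply]

theorem wt_eq_sum (μ : ℕ+ →₀ ℕ) : wt μ = ∑ k ∈ μ.support, (μ k : ℤ) * (k : ℕ) := by
  simp [wt, Finsupp.weight_apply, Finsupp.sum]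

theorem wt_nonneg (μ : ℕ+ →₀ ℕ) : 0 ≤ wt μ := by
  rw [wt_eq_sum]
  positivity

theorem wt_eq_zero_iff {μ : ℕ+ →₀ ℕ} : wt μ = 0 ↔ μ = 0 := by
  refine ⟨fun h => ?_, fun h => by rw [h, map_zero]⟩
  rw [wt_eq_sum, Finset.sum_eq_zero_iff_of_nonneg (fun k _ => by positivity)] at h
  ext k
  by_contra hk
  have := h k (Finsupp.mem_support_iff.mpr hk)
  simp at this
  exact hk this

theorem coeff_X_mul (μ : ℕ+ →₀ ℕ) (k : ℕ+) (f : PSeries) :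
    MvPowerSeries.coeff μ (MvPowerSeries.X k * f) =
      if μ k = 0 then 0 else MvPowerSeries.coeff (μ - Finsupp.single k 1) f := by
  split_ifs with h
  · exact coeff_X_mul_eq_zero h f
  · have hμ : Finsupp.single k 1 + (μ - Finsupp.single k 1) = μ :=
      add_tsub_cancel_of_le (by simpa [Nat.one_le_iff_ne_zero] using h)
    conv_lhs => rw [← hμ]
    rw [MvPowerSeries.X_def, MvPowerSeries.coeff_add_monomial_mul, one_mul]

theorem coeff_dP (μ : ℕ+ →₀ ℕ) (k : ℕ+) (f : PSeries) :
    MvPowerSeries.coeff μ (dP k f) =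
      MvPowerSeries.coeff (μ + Finsupp.single k 1) f * (μ k + 1) :=
  MvPowerSeries.coeff_pderiv ..

theorem coeff_mulP (μ : ℕ+ →₀ ℕ) (k : ℕ+) (f : PSeries) :
    MvPowerSeries.coeff μ (mulP k f) =
      if μ k = 0 then 0 else MvPowerSeries.coeff (μ - Finsupp.single k 1) f :=
  coeff_X_mul μ k f

theorem coeff_mulP_dP (μ : ℕ+ →₀ ℕ) (k : ℕ+) (f : PSeries) :
    MvPowerSeries.coeff μ (mulP k (dP k f)) = μ k * MvPowerSeries.coeff μ f := by
  rw [coeff_mulP]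
  split_ifs with h
  · simp [h]
  · have hμ : μ - Finsupp.single k 1 + Finsupp.single k 1 = μ :=
      tsub_add_cancel_of_le (by simpa [Nat.one_le_iff_ne_zero] using h)
    rw [coeff_dP, hμ, mul_comm]
    congr 1
    have h1 : 1 ≤ μ k := Nat.one_le_iff_ne_zero.mpr h
    simp [Finsupp.tsub_apply, Nat.cast_sub h1]

theorem coeff_opSum {ι : Type} {T : ι → Module.End ℂ PSeries} (hT : LocallyFiniteOps T)
    (μ : ℕ+ →₀ ℕ) (f : PSeries) :
    MvPowerSeries.coeff μ (opSum T hT f) = ∑ᶠ i, MvPowerSeries.coeff μ (T i f) := rfl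

/-- The projection of a power series to its part of weight `k`. -/
noncomputable def weightProj (k : ℤ) : Module.End ℂ PSeries where
  toFun f := fun μ => if wt μ = k then MvPowerSeries.coeff μ f else 0
  map_add' f g := by
    funext μ
    change (if wt μ = k then MvPowerSeries.coeff μ (f + g) else 0) =
      (if wt μ = k then MvPowerSeries.coeff μ f else 0) +
        (if wt μ = k then MvPowerSeries.coeff μ g else 0)
    split_ifs <;> simp
  map_smul' c f := by
    funext μ
    change (if wt μ = k then MvPowerSeries.coeff μ (c • f) else 0) =
      c • (if wt μ = k then MvPowerSeries.coeff μ f else 0)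
    split_ifs <;> simp

theorem coeff_weightProj (k : ℤ) (μ : ℕ+ →₀ ℕ) (f : PSeries) :
    MvPowerSeries.coeff μ (weightProj k f) = if wt μ = k then MvPowerSeries.coeff μ f else 0 :=
  rfl

/-- An operator is homogeneous of weight `d` if it maps series of weight `k` to series of weight
`k + d`, for all `k`. -/
def RaisesWeight (d : ℤ) (T : Module.End ℂ PSeries) : Prop :=
  ∀ k f, T (weightProj k f) = weightProj (k + d) (T f)

theorem raisesWeight_mulP (j : ℕ+) : RaisesWeight (j : ℕ) (mulP j) := by
  intro k f
  ext μ
  rw [coeff_mulP, coeff_weightProj, coeff_weightProj, coeff_mulP]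
  by_cases h : μ j = 0
  · simp [h]
  · have hμ : μ - Finsupp.single j 1 + Finsupp.single j 1 = μ :=
      tsub_add_cancel_of_le (by simpa [Nat.one_le_iff_ne_zero] using h)
    have hw : wt μ = wt (μ - Finsupp.single j 1) + (j : ℕ) := by
      conv_lhs => rw [← hμ, map_add, wt_single]
      simp
    simp only [h, if_false, hw, add_left_inj]

theorem raisesWeight_dP (j : ℕ+) : RaisesWeight (-(j : ℕ)) (dP j) := by
  intro k f
  ext μ
  rw [coeff_dP, coeff_weightProj, coeff_weightProj, coeff_dP, map_add, wt_single]
  have : wt μ + ((1 : ℕ) : ℤ) * ((j : ℕ) : ℤ) = k ↔ wt μ = k + -((j : ℕ) : ℤ) := by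
    constructor <;> intro h <;> push_cast at * <;> linarith
  simp only [this]
  split_ifs <;> simp

theorem RaisesWeight.mul {d e : ℤ} {S T : Module.End ℂ PSeries} (hS : RaisesWeight d S)
    (hT : RaisesWeight e T) : RaisesWeight (d + e) (S * T) := by
  intro k f
  rw [Module.End.mul_apply, hT, hS, Module.End.mul_apply, add_assoc, add_comm e]

theorem RaisesWeight.add {d : ℤ} {S T : Module.End ℂ PSeries} (hS : RaisesWeight d S)
    (hT : RaisesWeight d T) : RaisesWeight d (S + T) := by
  intro k f
  rw [LinearMap.add_apply, hS, hT, LinearMap.add_apply, map_add]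

theorem RaisesWeight.smul {d : ℤ} {T : Module.End ℂ PSeries} (hT : RaisesWeight d T) (c : ℂ) :
    RaisesWeight d (c • T) := by
  intro k f
  rw [LinearMap.smul_apply, hT, LinearMap.smul_apply, map_smul]

theorem RaisesWeight.opSum {d : ℤ} {ι : Type} {T : ι → Module.End ℂ PSeries}
    (h : LocallyFiniteOps T) (hT : ∀ i, RaisesWeight d (T i)) : RaisesWeight d (opSum T h) := by
  intro k f
  ext μ
  rw [coeff_weightProj, coeff_opSum, coeff_opSum]
  simp only [hT _ k f, coeff_weightProj]
  split_ifs <;> simp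

theorem RaisesWeight.congr {d e : ℤ} {T : Module.End ℂ PSeries} (hT : RaisesWeight d T)
    (h : d = e) : RaisesWeight e T := h ▸ hT

theorem coe_add_sub_one (i j : ℕ+) : (((i + j - 1 : ℕ+) : ℕ) : ℤ) = (i : ℕ) + (j : ℕ) - 1 := by
  have h1 := i.pos
  have h2 := j.pos
  rw [PNat.sub_coe, if_pos (by
    rw [← PNat.coe_lt_coe]
    simp only [PNat.add_coe, PNat.one_coe]
    omega)]
  simp only [PNat.add_coe, PNat.one_coe]
  omega

theorem raisesWeight_WLaguerre (x a : ℂ) (ε : ℝ) : RaisesWeight 1 (WLaguerre x a ε) := by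
  refine RaisesWeight.add (RaisesWeight.add (RaisesWeight.smul (.opSum _ fun k => ?_) _)
    (.opSum _ fun q => .add ?_ (.smul ?_ _))) (.smul ?_ _)
  · exact (((raisesWeight_mulP _).mul (raisesWeight_dP _)).smul _).congr (by push_cast; ring)
  · refine ((((raisesWeight_mulP _).mul (raisesWeight_mulP _)).mul
      (raisesWeight_dP _)).smul _).congr ?_
    rw [coe_add_sub_one]
    ring
  · refine ((((raisesWeight_mulP _).mul (raisesWeight_dP _)).mul
      (raisesWeight_dP _)).smul _).congr ?_
    push_cast
    ring
  · exact (raisesWeight_mulP 1).congr (by simp)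

/-- A series `Z` with constant term `1` and `E Z = W Z`, where `E` multiplies a monomial by its
weight, is `e^W 1`: as `W` raises weights by one, the part of weight `k` of `Z` is `W^k 1 / k!`. -/
theorem hasSum_exp_WLaguerre {x a : ℂ} {ε : ℝ} {Z : PSeries}
    (h0 : MvPowerSeries.coeff 0 Z = 1)
    (hE : ∀ μ, (wt μ : ℂ) * MvPowerSeries.coeff μ Z =
      MvPowerSeries.coeff μ (WLaguerre x a ε Z)) :
    HasSum (fun k : ℕ => ((k ! : ℂ)⁻¹) • ((WLaguerre x a ε) ^ k) (1 : PSeries)) Z := by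
  have key (k : ℕ) : ((WLaguerre x a ε) ^ k) (1 : PSeries) = (k ! : ℂ) • weightProj k Z := by
    induction k with
    | zero =>
      ext μ
      simp only [pow_zero, Module.End.one_apply, Nat.factorial_zero, Nat.cast_one, one_smul,
        coeff_weightProj, Nat.cast_zero, wt_eq_zero_iff, MvPowerSeries.coeff_one]
      split_ifs with h
      · rw [h, h0]
      · rfl
    | succ k ih =>
      rw [pow_succ', Module.End.mul_apply, ih, map_smul, raisesWeight_WLaguerre]
      ext μ
      simp only [map_smul, coeff_weightProj, ← hE, Nat.factorial_succ, Nat.cast_add, Nat.cast_one]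
      split_ifs with h
      · rw [h]
        push_cast
        simp only [smul_eq_mul]
        ring
      · simp
  rw [MvPowerSeries.WithPiTopology.hasSum_iff_hasSum_coeff]
  intro μ
  have hs := hasSum_single (f := fun k : ℕ => MvPowerSeries.coeff μ
      (((k ! : ℂ)⁻¹) • ((WLaguerre x a ε) ^ k) (1 : PSeries))) (wt μ).toNat fun k hk => by
    have hne : wt μ ≠ k := fun h => hk (by rw [h]; simp)
    simp only [key, map_smul, coeff_weightProj, hne, if_false, smul_zero]
  have hw : (((wt μ).toNat : ℕ) : ℤ) = wt μ := Int.toNat_of_nonneg (wt_nonneg μ)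
  have hf : (((wt μ).toNat)! : ℂ) ≠ 0 := by exact_mod_cast Nat.factorial_ne_zero _
  simpa only [key, smul_smul, inv_mul_cancel₀ hf, one_smul, coeff_weightProj, hw, if_true] using hs

/-! ### Virasoro constraints imply the cut-and-join equation -/

/-- The `j`-th term of the linear part `∑ j, p_j (j + k - 1) ∂/∂p_{j+k-1}` of the Virasoro
operator of index `k - 1`. -/
noncomputable def shiftTerm (k j : ℕ+) : Module.End ℂ PSeries :=
  (((k + j - 1 : ℕ+) : ℕ) : ℂ) • (mulP j * dP (k + j - 1))

theorem shiftTerm_locallyFinite (k : ℕ+) : LocallyFiniteOps (shiftTerm k) := by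
  intro μ
  refine μ.support.finite_toSet.subset ?_
  rintro j ⟨f, hf⟩
  rw [Finset.mem_coe, Finsupp.mem_support_iff]
  intro h
  exact hf (by simp [shiftTerm, coeff_mulP, h])

/-- The pairs of positive integers with sum `m`. -/
def pairsWithSum (m : ℕ+) : Finset (ℕ+ × ℕ+) :=
  (Finset.Icc 1 m ×ˢ Finset.Icc 1 m).filter fun q => q.1 + q.2 = m

theorem mem_pairsWithSum {m : ℕ+} {q : ℕ+ × ℕ+} : q ∈ pairsWithSum m ↔ q.1 + q.2 = m := by
  simp only [pairsWithSum, Finset.mem_filter, Finset.mem_product, Finset.mem_Icc, one_le,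
    true_and, and_iff_right_iff_imp]
  rintro rfl
  simp only [← PNat.coe_le_coe, PNat.add_coe]
  omega

theorem finsum_pnat_eq {f : ℕ+ → ℂ} (hf : (Function.support f).Finite) :
    ∑ᶠ k, f k = f 1 + ∑ᶠ m : ℕ+, f (m + 1) := by
  have h1 : ∑ᶠ m : ℕ+, f (m + 1) = ∑ᶠ (k) (_ : k ∈ Set.range fun m : ℕ+ => m + 1), f k :=
    (finsum_mem_range (fun a b h => by simpa using h)).symm
  have h2 : (Set.range fun m : ℕ+ => m + 1) = ({1} : Set ℕ+)ᶜ := by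
    ext k
    simp only [Set.mem_range, Set.mem_compl_iff, Set.mem_singleton_iff]
    constructor
    · rintro ⟨m, rfl⟩ h
      have := congrArg PNat.val h
      have := m.pos
      simp at *
    · intro h
      exact PNat.exists_eq_succ_of_ne_one h |>.imp fun m hm => hm.symm
  have h3 : f 1 = ∑ᶠ (k) (_ : k ∈ ({1} : Set ℕ+)), f k := finsum_mem_singleton.symm
  rw [h1, h2, h3, ← finsum_mem_union' disjoint_compl_right (hf.subset Set.inter_subset_right)
    (hf.subset Set.inter_subset_right), Set.union_compl_self, finsum_mem_univ]

theorem finite_support_finsum_curry {α β : Type} {f : α × β → ℂ} (hf : f.support.Finite) :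
    (Function.support fun a => ∑ᶠ b, f (a, b)).Finite := by
  refine (hf.image Prod.fst).subset fun a ha => ?_
  by_contra h
  refine ha (finsum_eq_zero_of_forall_eq_zero fun b => ?_)
  by_contra hb
  exact h ⟨(a, b), hb, rfl⟩

/-- The Virasoro constraint of index `k - 1`, multiplied by `p_k` and summed over `k`, is the
equation `E Z = W Z`. -/
theorem wt_mul_coeff_eq_of_virasoro {x a : ℂ} {ε : ℝ} {Z : PSeries}
    (h1 : dP 1 Z = (x * (x + a) / (ε : ℂ) ^ 2) • Z + opSum _ (shiftTerm_locallyFinite 1) Z)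
    (h2 : ∀ m : ℕ+, ((m : ℂ) + 1) • dP (m + 1) Z = ((2 * x + a) * m) • dP m Z
      + (ε : ℂ) ^ 2 • ∑ q ∈ pairsWithSum m, ((q.1 : ℂ) * (q.2 : ℂ)) • dP q.1 (dP q.2 Z)
      + opSum _ (shiftTerm_locallyFinite (m + 1)) Z) (μ : ℕ+ →₀ ℕ) :
    (wt μ : ℂ) * MvPowerSeries.coeff μ Z = MvPowerSeries.coeff μ (WLaguerre x a ε Z) := by
  set A : ℕ+ → ℂ := fun m => MvPowerSeries.coeff μ (lambdaTerm m Z) with hA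
  set B : ℕ+ × ℕ+ → ℂ := fun q => MvPowerSeries.coeff μ (cutTerm q Z) with hB
  set J : ℕ+ × ℕ+ → ℂ := fun q => MvPowerSeries.coeff μ (joinTerm q Z) with hJ
  set F : ℕ+ → ℂ := fun k => MvPowerSeries.coeff μ (mulP k ((k : ℂ) • dP k Z)) with hF
  have fA : A.support.Finite := lambdaTerm_locallyFinite.finite_support μ Z
  have fB : B.support.Finite := by
    simpa using (cut_join_locallyFinite 0).finite_support μ Z
  have fJ : J.support.Finite := by
    refine (((cut_join_locallyFinite 1).finite_support μ Z).union fB).subset ?_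
    intro q hq
    by_contra hn
    simp only [one_smul, LinearMap.add_apply, map_add, Set.mem_union, Function.mem_support,
      not_or, not_not] at hn
    refine hq ?_
    have := hn.1
    rw [show MvPowerSeries.coeff μ (cutTerm q Z) = 0 from hn.2, zero_add] at this
    exact this
  have hF' (k : ℕ+) : F k = (k : ℂ) * (μ k * MvPowerSeries.coeff μ Z) := by
    simp only [hF, map_smul, coeff_mulP_dP, smul_eq_mul]
  have fF : F.support.Finite := by
    refine μ.support.finite_toSet.subset fun k hk => ?_
    rw [Finset.mem_coe, Finsupp.mem_support_iff]
    intro h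
    exact hk (by rw [hF', h]; simp)
  -- the left-hand side is the sum of `p_k k ∂/∂p_k`
  have hleft : (wt μ : ℂ) * MvPowerSeries.coeff μ Z = ∑ᶠ k, F k := by
    rw [finsum_eq_sum_of_support_subset (s := μ.support), wt_eq_sum]
    · push_cast
      rw [Finset.sum_mul]
      refine Finset.sum_congr rfl fun k _ => ?_
      rw [hF']
      ring
    · intro k hk
      rw [Finset.mem_coe, Finsupp.mem_support_iff]
      intro h
      exact hk (by rw [hF', h]; simp)
  have hcut (k : ℕ+) : MvPowerSeries.coeff μ (mulP k (opSum _ (shiftTerm_locallyFinite k) Z)) =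
      ∑ᶠ j, B (k, j) := by
    rw [coeff_mulP]
    split_ifs with h
    · rw [finsum_eq_zero_of_forall_eq_zero]
      intro j
      simp [hB, cutTerm, coeff_mulP, h]
    · rw [coeff_opSum]
      refine finsum_congr fun j => ?_
      simp [hB, cutTerm, shiftTerm, coeff_mulP, h]
  have hF1 : F 1 = x * (x + a) / (ε : ℂ) ^ 2 * MvPowerSeries.coeff μ (mulP 1 Z)
      + ∑ᶠ j, B (1, j) := by
    rw [← hcut]
    simp only [hF, PNat.one_coe, Nat.cast_one, one_smul]
    rw [h1, map_add, map_add, map_smul, map_smul, smul_eq_mul]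
  have hFm (m : ℕ+) : F (m + 1) = (2 * x + a) * A m
      + (ε : ℂ) ^ 2 * ∑ᶠ q : ℕ+ × ℕ+, (if q.1 + q.2 = m then J q else 0)
      + ∑ᶠ j, B (m + 1, j) := by
    have hj : ∑ᶠ q : ℕ+ × ℕ+, (if q.1 + q.2 = m then J q else 0) =
        ∑ q ∈ pairsWithSum m, J q := by
      rw [finsum_eq_sum_of_support_subset (s := pairsWithSum m)]
      · exact Finset.sum_congr rfl fun q hq => if_pos (mem_pairsWithSum.mp hq)
      · intro q hq
        rw [Finset.mem_coe, mem_pairsWithSum]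
        by_contra h
        exact hq (if_neg h)
    rw [hj, ← hcut]
    have : F (m + 1) = MvPowerSeries.coeff μ (mulP (m + 1) (((m : ℂ) + 1) • dP (m + 1) Z)) := by
      simp [hF]
    rw [this, h2]
    simp only [map_add, map_smul, map_sum, smul_eq_mul, hA, hJ, lambdaTerm, joinTerm,
      LinearMap.smul_apply, Module.End.mul_apply]
    congr 2
    · ring
    · congr 1
      refine Finset.sum_congr rfl fun q hq => ?_
      rw [mem_pairsWithSum.mp hq]
  have fJm : (Function.support fun p : ℕ+ × (ℕ+ × ℕ+) =>
      if p.2.1 + p.2.2 = p.1 then J p.2 else 0).Finite := by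
    refine (fJ.image fun q => (q.1 + q.2, q)).subset ?_
    rintro ⟨m, q⟩ h
    simp only [Function.mem_support, ne_eq, ite_eq_right_iff, Classical.not_imp] at h
    exact ⟨q, h.2, Prod.ext h.1 rfl⟩
  have hJsum : ∑ᶠ q, J q =
      ∑ᶠ m : ℕ+, ∑ᶠ q : ℕ+ × ℕ+, (if q.1 + q.2 = m then J q else 0) := by
    rw [← finsum_curry (fun p : ℕ+ × (ℕ+ × ℕ+) => if p.2.1 + p.2.2 = p.1 then J p.2 else 0) fJm]
    rw [← finsum_comp_equiv (Equiv.prodComm (ℕ+ × ℕ+) ℕ+),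
      finsum_curry (fun p : (ℕ+ × ℕ+) × ℕ+ => _) (fJm.preimage (Equiv.injective _).injOn)]
    refine finsum_congr fun q => ?_
    rw [finsum_eq_single _ (q.1 + q.2) fun m hm => if_neg fun h => hm h.symm]
    exact (if_pos rfl).symm
  have hBsum : ∑ᶠ q, B q = ∑ᶠ j, B (1, j) + ∑ᶠ m : ℕ+, ∑ᶠ j, B (m + 1, j) := by
    rw [finsum_curry B fB, finsum_pnat_eq (finite_support_finsum_curry fB)]
  have hright : MvPowerSeries.coeff μ (WLaguerre x a ε Z) =
      (2 * x + a) * ∑ᶠ m, A m + (∑ᶠ q, B q + (ε : ℂ) ^ 2 * ∑ᶠ q, J q)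
        + x * (x + a) / (ε : ℂ) ^ 2 * MvPowerSeries.coeff μ (mulP 1 Z) := by
    simp only [WLaguerre, M1, Lambda1, LinearMap.add_apply, LinearMap.smul_apply, map_add,
      map_smul, coeff_opSum, smul_eq_mul]
    rw [finsum_add_distrib fB (fJ.subset fun q hq h => hq (by
      rw [show MvPowerSeries.coeff μ (joinTerm q Z) = 0 from h, mul_zero]))]
    rw [mul_finsum, mul_finsum]
  have s1 : (Function.support fun m => (2 * x + a) * A m).Finite :=
    fA.subset fun q hq h => hq (by simp [h])
  have s2 : (Function.support fun m : ℕ+ => (ε : ℂ) ^ 2 *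
      ∑ᶠ q : ℕ+ × ℕ+, (if q.1 + q.2 = m then J q else 0)).Finite := by
    exact (finite_support_finsum_curry fJm).subset fun k hk => right_ne_zero_of_mul hk
  have s3 : (Function.support fun m : ℕ+ => ∑ᶠ j, B (m + 1, j)).Finite := by
    exact (finite_support_finsum_curry fB).preimage (f := fun m : ℕ+ => m + 1)
      (fun a _ b _ h => by simpa using h)
  rw [hleft, hright, finsum_pnat_eq fF, hF1, finsum_congr hFm, finsum_add_distrib _ s3,
    finsum_add_distrib s1 s2, hBsum, hJsum, ← mul_finsum, ← mul_finsum]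
  · ring
  · exact (s1.union s2).subset (Function.support_add _ _)

open Filter Topology

/-! ### The functional equation of the Barnes `G`-function -/

/-- The `k`-th factor, counted from `k = 0`, of the Weierstrass product of `G(1 + w)`. -/
noncomputable def barnesFactor (w : ℂ) (k : ℕ) : ℂ :=
  (1 + w / ((k : ℂ) + 1)) ^ (k + 1) * Complex.exp (-w + w ^ 2 / (2 * ((k : ℂ) + 1)))

theorem add_natCast_ne_zero {s : ℂ} (hs : 0 < s.re) (k : ℕ) : s + k ≠ 0 := by
  intro h
  have := congrArg Complex.re h
  simp at this
  have : (0 : ℝ) ≤ k := k.cast_nonneg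
  linarith

/-- To the right of `Re w = -1` the Weierstrass product is the exponential of an absolutely
convergent series, so that it converges and does not vanish. -/
theorem exists_hasProd_barnesFactor {w : ℂ} (hw : -1 < w.re) :
    ∃ c, HasProd (barnesFactor w) (Complex.exp c) := by
  set u : ℕ → ℂ := fun k => w / ((k : ℂ) + 1) with hu
  set g : ℕ → ℂ := fun k =>
    ((k : ℂ) + 1) * (Complex.log (1 + u k) - (u k - (u k) ^ 2 / 2)) with hg
  have hk (k : ℕ) : (k : ℂ) + 1 ≠ 0 := by exact_mod_cast k.succ_ne_zero
  have hexp (k : ℕ) : Complex.exp (g k) = barnesFactor w k := by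
    have h1 : 1 + u k ≠ 0 := by
      have := add_natCast_ne_zero (s := 1 + w) (by simp; linarith) k
      have h2 : 1 + u k = (1 + w + k) / ((k : ℂ) + 1) := by
        have := hk k
        simp only [hu]; field_simp; ring
      rw [h2]
      exact div_ne_zero this (hk k)
    have h2 : g k = ((k + 1 : ℕ) : ℂ) * Complex.log (1 + u k)
        + (-w + w ^ 2 / (2 * ((k : ℂ) + 1))) := by
      have := hk k
      simp only [hg, hu]; push_cast; field_simp; ring
    rw [h2, Complex.exp_add, Complex.exp_nat_mul, Complex.exp_log h1]
    rfl
  have hsum : Summable g := by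
    have hO : (fun k : ℕ => u k) =O[Filter.atTop] fun k : ℕ => ((k : ℝ) + 1)⁻¹ := by
      refine Asymptotics.IsBigO.of_bound ‖w‖ (Filter.Eventually.of_forall fun k => ?_)
      have : ‖(k : ℂ) + 1‖ = (k : ℝ) + 1 := by
        have := Complex.norm_natCast (k + 1); push_cast at this; exact this
      simp only [hu]
      rw [norm_div, this, Real.norm_of_nonneg (by positivity), div_eq_mul_inv]
    have h0 : Filter.Tendsto u Filter.atTop (nhds 0) := by
      refine hO.trans_tendsto ?_
      exact tendsto_inv_atTop_zero.comp
        (Filter.tendsto_atTop_add_const_right _ _ tendsto_natCast_atTop_atTop)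
    have h1 : (fun k => Complex.log (1 + u k) - (u k - (u k) ^ 2 / 2))
        =O[Filter.atTop] fun k => (u k) ^ 3 := by
      have h := (Complex.log_sub_logTaylor_isBigO 2).comp_tendsto h0
      refine h.congr_left fun k => ?_
      simp [Complex.logTaylor_succ, Complex.logTaylor_zero]
      ring
    have h2 : (fun k : ℕ => ((k : ℂ) + 1)) =O[Filter.atTop] fun k : ℕ => ((k : ℝ) + 1) := by
      refine Asymptotics.IsBigO.of_bound 1 (Filter.Eventually.of_forall fun k => ?_)
      have : ‖(k : ℂ) + 1‖ = (k : ℝ) + 1 := by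
        have := Complex.norm_natCast (k + 1); push_cast at this; exact this
      rw [this, Real.norm_of_nonneg (by positivity), one_mul]
    have h3 := h2.mul (h1.trans (hO.pow 3))
    have h4 : Summable fun k : ℕ => ((k : ℝ) + 1) * ((k : ℝ) + 1)⁻¹ ^ 3 := by
      have := (summable_nat_add_iff 1).mpr (Real.summable_nat_pow_inv (p := 2).mpr (by norm_num))
      refine this.congr fun k => ?_
      have : (k : ℝ) + 1 ≠ 0 := by positivity
      push_cast
      field_simp
    exact summable_of_isBigO_nat h4 h3
  refine ⟨∑' k, g k, ?_⟩
  have := hsum.hasSum.cexp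
  convert this using 1
  funext k
  exact (hexp k).symm

/-- The partial products for `w + 1` and `w` differ by a telescoping product, written with
`s = w + 1`. -/
theorem prod_barnesFactor_add_one {s : ℂ} (hs : 0 < s.re) (N : ℕ) :
    ∏ k ∈ Finset.range N, barnesFactor s k =
      (∏ k ∈ Finset.range N, barnesFactor (s - 1) k) *
        ((s + N) ^ N / (∏ k ∈ Finset.range N, (s + k)) *
          Complex.exp (-N + (s - 1 / 2) * (harmonic N : ℂ))) := by
  induction N with
  | zero => simp
  | succ N ih =>
    have hprod : ∏ k ∈ Finset.range N, (s + k) ≠ 0 :=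
      Finset.prod_ne_zero_iff.mpr fun k _ => add_natCast_ne_zero hs k
    have hN := add_natCast_ne_zero hs N
    have hk : (N : ℂ) + 1 ≠ 0 := by exact_mod_cast N.succ_ne_zero
    rw [Finset.prod_range_succ, Finset.prod_range_succ, Finset.prod_range_succ, ih, harmonic_succ]
    have e1 : barnesFactor s N = ((s + (N + 1 : ℕ)) / ((N : ℂ) + 1)) ^ (N + 1) *
        Complex.exp (-s + s ^ 2 / (2 * ((N : ℂ) + 1))) := by
      unfold barnesFactor
      congr 2
      push_cast; field_simp; ring
    have e2 : barnesFactor (s - 1) N = ((s + N) / ((N : ℂ) + 1)) ^ (N + 1) *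
        Complex.exp (-(s - 1) + (s - 1) ^ 2 / (2 * ((N : ℂ) + 1))) := by
      unfold barnesFactor
      congr 2
      field_simp; ring
    rw [e1, e2]
    have e3 : Complex.exp (-s + s ^ 2 / (2 * ((N : ℂ) + 1))) *
        Complex.exp (-N + (s - 1 / 2) * (harmonic N : ℂ)) =
        Complex.exp (-(s - 1) + (s - 1) ^ 2 / (2 * ((N : ℂ) + 1))) *
        Complex.exp (-(N + 1 : ℕ) + (s - 1 / 2) * ((harmonic N + (↑(N + 1))⁻¹ : ℚ) : ℂ)) := by
      rw [← Complex.exp_add, ← Complex.exp_add]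
      congr 1
      push_cast; field_simp; ring
    rw [div_pow, div_pow]
    calc _ = (∏ k ∈ Finset.range N, barnesFactor (s - 1) k) *
          ((s + N) ^ N / (∏ k ∈ Finset.range N, (s + k))) *
          ((s + (N + 1 : ℕ)) ^ (N + 1) / ((N : ℂ) + 1) ^ (N + 1)) *
          (Complex.exp (-s + s ^ 2 / (2 * ((N : ℂ) + 1))) *
            Complex.exp (-N + (s - 1 / 2) * (harmonic N : ℂ))) := by ring
      _ = _ := by
        rw [e3]
        field_simp
        ring

/-- The telescoped factor tends to the quotient of Barnes functions, by Euler's limit formula for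
`Γ`, Stirling's formula and the definition of Euler's constant. -/
theorem tendsto_barnes_quotient {s : ℂ} (hs : 0 < s.re) :
    Tendsto (fun N : ℕ => (s + N) ^ N / (∏ k ∈ Finset.range N, (s + k)) *
          Complex.exp (-N + (s - 1 / 2) * (harmonic N : ℂ))) atTop
      (𝓝 (Complex.Gamma s * Complex.exp s *
        Complex.exp ((s - 1 / 2) * Real.eulerMascheroniConstant) /
          ((√Real.pi : ℝ) * (√2 : ℝ) : ℂ))) := by
  have hG := Complex.GammaSeq_tendsto_Gamma s
  have hE := Complex.tendsto_one_add_div_pow_exp s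
  have hlin : Tendsto (fun N : ℕ => 1 + s / (N : ℂ)) atTop (𝓝 1) := by
    simpa using (tendsto_const_div_atTop_nhds_zero_nat s).const_add 1
  have hγ : Tendsto (fun N : ℕ => Complex.exp
      ((s - 1 / 2) * ((harmonic N - Real.log N : ℝ) : ℂ))) atTop
      (𝓝 (Complex.exp ((s - 1 / 2) * Real.eulerMascheroniConstant))) :=
    (Complex.continuous_exp.tendsto _).comp
      (((Complex.continuous_ofReal.tendsto _).comp Real.tendsto_harmonic_sub_log).const_mul _)
  have hS : Tendsto (fun N : ℕ => ((Stirling.stirlingSeq N : ℝ) : ℂ)) atTop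
      (𝓝 ((√Real.pi : ℝ) : ℂ)) :=
    (Complex.continuous_ofReal.tendsto _).comp Stirling.tendsto_stirlingSeq_sqrt_pi
  have hpi : ((√Real.pi : ℝ) * (√2 : ℝ) : ℂ) ≠ 0 := by
    norm_cast
    positivity
  have h := (((hG.mul hE).mul hlin).mul hγ).div (hS.mul_const ((√2 : ℝ) : ℂ)) hpi
  rw [mul_one] at h
  refine h.congr' ?_
  filter_upwards [eventually_ge_atTop 1] with N hN
  have hN0 : (N : ℂ) ≠ 0 := by exact_mod_cast (by omega : N ≠ 0)
  have hNpos : (0 : ℝ) < N := by exact_mod_cast hN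
  have hprod : ∏ k ∈ Finset.range N, (s + k) ≠ 0 :=
    Finset.prod_ne_zero_iff.mpr fun k _ => add_natCast_ne_zero hs k
  have hsN := add_natCast_ne_zero hs N
  have hfac : (N ! : ℂ) ≠ 0 := by exact_mod_cast N.factorial_ne_zero
  have hsq : ((√(N : ℝ) : ℝ) : ℂ) ≠ 0 := by
    norm_cast
    positivity
  have hsqN : ((√(N : ℝ) : ℝ) : ℂ) * ((√(N : ℝ) : ℝ) : ℂ) = N := by
    norm_cast
    exact Real.mul_self_sqrt hNpos.le
  have h2 : ((√(2 : ℝ) : ℝ) : ℂ) ≠ 0 := by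
    norm_cast
    positivity
  have hst : ((Stirling.stirlingSeq N : ℝ) : ℂ) * ((√2 : ℝ) : ℂ) =
      N ! * Complex.exp N / ((√(N : ℝ) : ℝ) * (N : ℂ) ^ N) := by
    unfold Stirling.stirlingSeq
    rw [Real.sqrt_mul (by norm_num : (0:ℝ) ≤ 2), div_pow, ← Real.exp_nat_mul, mul_one]
    push_cast
    field_simp
  have hlog : Complex.exp (-N + (s - 1 / 2) * (harmonic N : ℂ)) =
      (Complex.exp N)⁻¹ * ((N : ℂ) ^ s / (√(N : ℝ) : ℝ)) * Complex.exp
      ((s - 1 / 2) * ((harmonic N - Real.log N : ℝ) : ℂ)) := by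
    have e1 : ((√(N : ℝ) : ℝ) : ℂ) = Complex.exp ((1 / 2) * (Real.log N : ℂ)) := by
      rw [Real.sqrt_eq_rpow, Real.rpow_def_of_pos hNpos, Complex.ofReal_exp]
      push_cast
      ring_nf
    have e2 : (N : ℂ) ^ s = Complex.exp ((Real.log N : ℂ) * s) := by
      rw [Complex.cpow_def_of_ne_zero hN0, Complex.natCast_log]
    rw [e1, e2, ← Complex.exp_sub, ← Complex.exp_neg, ← Complex.exp_add, ← Complex.exp_add]
    congr 1
    push_cast
    ring
  rw [Pi.div_apply, hst, hlog]
  have hpow : (1 + s / (N : ℂ)) ^ N = (s + N) ^ N / (N : ℂ) ^ N := by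
    rw [← div_pow]
    congr 1
    field_simp
    ring
  simp only [hpow, Complex.GammaSeq, Finset.prod_range_succ]
  have := Complex.exp_ne_zero (N : ℂ)
  have : (N : ℂ) ^ N ≠ 0 := pow_ne_zero _ hN0
  field_simp
  rw [← hsqN]
  ring

theorem barnesG_eq (z : ℂ) : barnesG z = ((2 * Real.pi : ℝ) : ℂ) ^ ((z - 1) / 2) *
    Complex.exp (-((z - 1) * (z - 1 + 1)) / 2
      - (Real.eulerMascheroniConstant : ℂ) * (z - 1) ^ 2 / 2) * ∏' k, barnesFactor (z - 1) k := rfl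

theorem barnesG_ne_zero {z : ℂ} (hz : 0 < z.re) : barnesG z ≠ 0 := by
  obtain ⟨c, hc⟩ := exists_hasProd_barnesFactor (w := z - 1) (by simp; linarith)
  rw [barnesG_eq, hc.tprod_eq]
  refine mul_ne_zero (mul_ne_zero ?_ (Complex.exp_ne_zero _)) (Complex.exp_ne_zero _)
  rw [Complex.cpow_def_of_ne_zero (by norm_cast; positivity)]
  exact Complex.exp_ne_zero _

/-- The functional equation of `G` on the half-plane `Re z > 0`, where both products are exponentials
of convergent series. -/
theorem barnesG_add_one {z : ℂ} (hz : 0 < z.re) :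
    barnesG (z + 1) = Complex.Gamma z * barnesG z := by
  obtain ⟨c, hc⟩ := exists_hasProd_barnesFactor (w := z - 1) (by simp; linarith)
  obtain ⟨d, hd⟩ := exists_hasProd_barnesFactor (w := z) (by linarith)
  have hlim := hc.tendsto_prod_nat.mul (tendsto_barnes_quotient hz)
  have heq := tendsto_nhds_unique hd.tendsto_prod_nat
    (hlim.congr fun N => (prod_barnesFactor_add_one hz N).symm)
  have h0 : ((2 * Real.pi : ℝ) : ℂ) ≠ 0 := by norm_cast; positivity
  have hsqrt : ((2 * Real.pi : ℝ) : ℂ) ^ (z / 2) =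
      ((2 * Real.pi : ℝ) : ℂ) ^ ((z - 1) / 2) * ((√Real.pi : ℝ) * (√2 : ℝ) : ℂ) := by
    have : ((√Real.pi : ℝ) * (√2 : ℝ) : ℂ) = ((2 * Real.pi : ℝ) : ℂ) ^ (1 / 2 : ℂ) := by
      rw [← Complex.ofReal_mul, ← Real.sqrt_mul Real.pi_pos.le, Real.sqrt_eq_rpow,
        Complex.ofReal_cpow (by positivity), mul_comm]
      norm_num
    rw [this, ← Complex.cpow_add _ _ h0]
    congr 1
    ring
  have hpi : ((√Real.pi : ℝ) * (√2 : ℝ) : ℂ) ≠ 0 := by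
    norm_cast
    positivity
  rw [barnesG_eq, barnesG_eq, hc.tprod_eq, add_sub_cancel_right, hd.tprod_eq, heq, hsqrt]
  have hexp : Complex.exp (-(z * (z + 1)) / 2 - (Real.eulerMascheroniConstant : ℂ) * z ^ 2 / 2) *
      Complex.exp z * Complex.exp ((z - 1 / 2) * Real.eulerMascheroniConstant) =
      Complex.exp (-((z - 1) * (z - 1 + 1)) / 2
        - (Real.eulerMascheroniConstant : ℂ) * (z - 1) ^ 2 / 2) := by
    rw [← Complex.exp_add, ← Complex.exp_add]
    congr 1
    ring
  rw [← hexp]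
  have h3 : ((2 * Real.pi : ℝ) : ℂ) ^ ((z - 1) / 2) ≠ 0 := by
    rw [Complex.cpow_def_of_ne_zero h0]
    exact Complex.exp_ne_zero _
  field_simp

theorem barnesG_add_natCast {z : ℂ} (hz : 0 < z.re) (n : ℕ) :
    barnesG (z + n) = (∏ j ∈ Finset.range n, Complex.Gamma (z + j)) * barnesG z := by
  induction n with
  | zero => simp
  | succ n ih =>
    have h : 0 < (z + n).re := by
      simp only [Complex.add_re, Complex.natCast_re]
      positivity
    rw [Finset.prod_range_succ, mul_right_comm, ← ih, mul_comm, ← barnesG_add_one h]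
    push_cast
    ring_nf

open MeasureTheory

/-! ### Peeling off the first row of a Hermitian matrix -/

/-- Strictly upper triangular positions of an `(n + 1) × (n + 1)` matrix: those in the first row
and those of the lower right `n × n` block. -/
noncomputable def upperEquiv (n : ℕ) : Fin n ⊕ {q : Fin n × Fin n // q.1 < q.2} ≃
    {q : Fin (n + 1) × Fin (n + 1) // q.1 < q.2} :=
  Equiv.ofBijective
    (Sum.elim (fun j => ⟨(0, j.succ), Fin.succ_pos j⟩)
      fun q => ⟨(q.1.1.succ, q.1.2.succ), Fin.succ_lt_succ_iff.mpr q.2⟩) <| by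
    constructor
    · rintro (i | ⟨⟨i, i'⟩, hi⟩) (j | ⟨⟨j, j'⟩, hj⟩) h <;> simp at h ⊢
      · exact h
      · exact absurd h.1.symm (Fin.succ_ne_zero _)
      · exact h
    · rintro ⟨⟨i, j⟩, h⟩
      have h' : i < j := h
      obtain ⟨j, rfl⟩ := Fin.exists_succ_eq.mpr (Fin.ne_zero_of_lt h')
      rcases Fin.eq_zero_or_eq_succ i with rfl | ⟨i, rfl⟩
      · exact ⟨Sum.inl j, rfl⟩
      · exact ⟨Sum.inr ⟨(i, j), Fin.succ_lt_succ_iff.mp h'⟩, rfl⟩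

/-- Coordinates of a Hermitian matrix with first row `(d, b)` and lower right block `A`. -/
noncomputable def borderEquiv (n : ℕ) :
    (ℝ × (Fin n → ℂ)) × HermCoord n ≃ᵐ HermCoord (n + 1) where
  toFun p := (Fin.cons p.1.1 p.2.1, fun q => Sum.elim p.1.2 p.2.2 ((upperEquiv n).symm q))
  invFun c := ((c.1 0, fun j => c.2 (upperEquiv n (Sum.inl j))),
    (fun i => c.1 i.succ, fun q => c.2 (upperEquiv n (Sum.inr q))))
  left_inv p := by simp
  right_inv c := by
    refine Prod.ext ?_ ?_
    · ext i
      refine Fin.cases ?_ (fun i => ?_) i <;> simp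
    · ext q
      obtain ⟨s, rfl⟩ := (upperEquiv n).surjective q
      rcases s with j | q <;> simp
  measurable_toFun := by
    refine Measurable.prodMk ?_ ?_
    · refine measurable_pi_lambda _ fun i => ?_
      refine Fin.cases ?_ (fun i => ?_) i
      · simp only [Fin.cons_zero]; fun_prop
      · simp only [Fin.cons_succ]; fun_prop
    · refine measurable_pi_lambda _ fun q => ?_
      obtain ⟨s, rfl⟩ := (upperEquiv n).surjective q
      rcases s with j | q <;> simp <;> fun_prop
  measurable_invFun := by
    simp only [Equiv.coe_fn_symm_mk]
    fun_prop

theorem measurePreserving_borderEquiv (n : ℕ) : MeasurePreserving (borderEquiv n) := by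
  have h1 := (volume_preserving_piFinSuccAbove (fun _ : Fin (n + 1) => ℝ) 0).symm
  have h2 := (volume_measurePreserving_piCongrLeft (fun _ => ℂ) (upperEquiv n)).comp
    (volume_measurePreserving_sumPiEquivProdPi_symm
      (fun _ : Fin n ⊕ {q : Fin n × Fin n // q.1 < q.2} => ℂ))
  have h3 : MeasurePreserving (fun p : (ℝ × (Fin n → ℂ)) × HermCoord n =>
      ((p.1.1, p.2.1), (p.1.2, p.2.2))) := by
    have h4 : MeasurePreserving (fun p : (Fin n → ℂ) × HermCoord n => (p.2.1, (p.1, p.2.2))) :=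
      (volume_preserving_prodAssoc.comp
        ((Measure.measurePreserving_swap (μ := volume) (ν := volume)).prod
          (MeasurePreserving.id volume))).comp volume_preserving_prodAssoc.symm
    exact (volume_preserving_prodAssoc.symm.comp
      ((MeasurePreserving.id volume).prod h4)).comp volume_preserving_prodAssoc
  have h := (h1.prod h2).comp h3
  have heq : ⇑(borderEquiv n) =
      Prod.map (⇑(MeasurableEquiv.piFinSuccAbove (fun _ => ℝ) 0).symm)
        (⇑(MeasurableEquiv.piCongrLeft (fun _ => ℂ) (upperEquiv n)) ∘
          ⇑(MeasurableEquiv.sumPiEquivProdPi fun _ => ℂ).symm) ∘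
        fun p : (ℝ × (Fin n → ℂ)) × HermCoord n => ((p.1.1, p.2.1), p.1.2, p.2.2) := by
    ext1 p
    refine Prod.ext ?_ ?_
    · ext i
      refine Fin.cases ?_ (fun i => ?_) i <;>
        simp [borderEquiv, MeasurableEquiv.piFinSuccAbove, Fin.insertNthEquiv]
    · ext q
      obtain ⟨s, rfl⟩ := (upperEquiv n).surjective q
      simp only [borderEquiv, MeasurableEquiv.coe_mk, Equiv.coe_fn_mk, Equiv.symm_apply_apply,
        Function.comp, Prod.map, MeasurableEquiv.piCongrLeft, Equiv.piCongrLeft_apply_apply]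
      rcases s with j | q <;> rfl
  rw [heq]
  exact h

instance isAddHaarMeasure_hermCoord (n : ℕ) : (volume : Measure (HermCoord n)).IsAddHaarMeasure :=
  Measure.prod.instIsAddHaarMeasure (volume : Measure (Fin n → ℝ))
    (volume : Measure ({q : Fin n × Fin n // q.1 < q.2} → ℂ))

/-- Coordinates of the rank one matrix with entries `conj (b i) * b j / d`. -/
noncomputable def rankOneCoord {n : ℕ} (p : ℝ × (Fin n → ℂ)) : HermCoord n :=
  (fun i => ‖p.2 i‖ ^ 2 / p.1, fun q => starRingEnd ℂ (p.2 q.1.1) * p.2 q.1.2 / p.1)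

theorem measurable_rankOneCoord {n : ℕ} :
    Measurable (rankOneCoord : ℝ × (Fin n → ℂ) → HermCoord n) := by
  refine Measurable.prodMk ?_ ?_
  · refine measurable_pi_lambda _ fun i => ?_
    fun_prop
  · refine measurable_pi_lambda _ fun q => ?_
    have : Measurable (starRingEnd ℂ) := Complex.continuous_conj.measurable
    fun_prop

/-- The Schur complement as a shear of coordinates: the Hermitian matrix with first row `(d, b)`
whose Schur complement of the entry `d` is `A`. -/
noncomputable def schurEquiv (n : ℕ) :
    (ℝ × (Fin n → ℂ)) × HermCoord n ≃ᵐ HermCoord (n + 1) :=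
  MeasurableEquiv.trans
    { toFun := fun p => (p.1, rankOneCoord p.1 + p.2)
      invFun := fun p => (p.1, -rankOneCoord p.1 + p.2)
      left_inv := fun p => by simp
      right_inv := fun p => by simp
      measurable_toFun := measurable_fst.prodMk
        ((measurable_rankOneCoord.comp measurable_fst).add measurable_snd)
      measurable_invFun := measurable_fst.prodMk
        ((measurable_rankOneCoord.comp measurable_fst).neg.add measurable_snd) }
    (borderEquiv n)

theorem measurePreserving_schurEquiv (n : ℕ) : MeasurePreserving (schurEquiv n) := by
  have h : MeasurePreserving (fun p : (ℝ × (Fin n → ℂ)) × HermCoord n =>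
      (p.1, rankOneCoord p.1 + p.2)) := by
    refine MeasurePreserving.skew_product (f := id) (g := fun p c => rankOneCoord p + c)
      (MeasurePreserving.id volume) ?_ (Filter.Eventually.of_forall fun p => ?_)
    · exact (measurable_rankOneCoord.comp measurable_fst).add measurable_snd
    · exact (measurePreserving_add_left volume (rankOneCoord p)).map_eq
  exact (measurePreserving_borderEquiv n).comp h

theorem upperEquiv_symm_zero_succ {n : ℕ} (j : Fin n) (h : (0 : Fin (n + 1)) < j.succ) :
    (upperEquiv n).symm ⟨(0, j.succ), h⟩ = Sum.inl j :=
  (Equiv.symm_apply_eq _).mpr rfl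

theorem upperEquiv_symm_succ_succ {n : ℕ} (i j : Fin n) (h : i.succ < j.succ) :
    (upperEquiv n).symm ⟨(i.succ, j.succ), h⟩ = Sum.inr ⟨(i, j), Fin.succ_lt_succ_iff.mp h⟩ :=
  (Equiv.symm_apply_eq _).mpr rfl

theorem hermOf_schurEquiv_zero_zero {n : ℕ} (p : (ℝ × (Fin n → ℂ)) × HermCoord n) :
    hermOf (schurEquiv n p) 0 0 = p.1.1 := by
  simp [hermOf, schurEquiv, borderEquiv]

theorem hermOf_schurEquiv_zero_succ {n : ℕ} (p : (ℝ × (Fin n → ℂ)) × HermCoord n) (j : Fin n) :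
    hermOf (schurEquiv n p) 0 j.succ = p.1.2 j := by
  simp [hermOf, schurEquiv, borderEquiv, upperEquiv_symm_zero_succ]

theorem hermOf_schurEquiv_succ_zero {n : ℕ} (p : (ℝ × (Fin n → ℂ)) × HermCoord n) (i : Fin n) :
    hermOf (schurEquiv n p) i.succ 0 = starRingEnd ℂ (p.1.2 i) := by
  simp [hermOf, schurEquiv, borderEquiv, upperEquiv_symm_zero_succ]

theorem hermOf_schurEquiv_succ_succ {n : ℕ} (p : (ℝ × (Fin n → ℂ)) × HermCoord n) (i j : Fin n) :
    hermOf (schurEquiv n p) i.succ j.succ =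
      starRingEnd ℂ (p.1.2 i) * p.1.2 j / p.1.1 + hermOf p.2 i j := by
  rcases lt_trichotomy i j with h | h | h
  · simp [hermOf, schurEquiv, borderEquiv, upperEquiv_symm_succ_succ, h, rankOneCoord]
  · subst h
    simp [hermOf, schurEquiv, borderEquiv, rankOneCoord, Complex.conj_mul']
  · simp [hermOf, schurEquiv, borderEquiv, upperEquiv_symm_succ_succ, h, h.not_gt, rankOneCoord,
      mul_comm]

theorem trace_hermOf_schurEquiv {n : ℕ} (p : (ℝ × (Fin n → ℂ)) × HermCoord n) :
    (hermOf (schurEquiv n p)).trace =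
      p.1.1 + (∑ i, (‖p.1.2 i‖ : ℂ) ^ 2) / p.1.1 + (hermOf p.2).trace := by
  simp only [Matrix.trace, Matrix.diag, Fin.sum_univ_succ, hermOf_schurEquiv_zero_zero,
    hermOf_schurEquiv_succ_succ, Finset.sum_add_distrib, Complex.conj_mul', Finset.sum_div]
  ring

/-- The bijection that splits off the first index. -/
def headEquiv (n : ℕ) : Unit ⊕ Fin n ≃ Fin (n + 1) where
  toFun := Sum.elim (fun _ => 0) Fin.succ
  invFun := Fin.cases (Sum.inl ()) Sum.inr
  left_inv := by rintro (_ | i) <;> simp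
  right_inv i := by refine Fin.cases ?_ (fun i => ?_) i <;> simp

theorem hermOf_schurEquiv_submatrix {n : ℕ} (p : (ℝ × (Fin n → ℂ)) × HermCoord n) :
    (hermOf (schurEquiv n p)).submatrix (headEquiv n) (headEquiv n) =
      Matrix.fromBlocks (Matrix.diagonal fun _ : Unit => (p.1.1 : ℂ))
        (Matrix.of fun _ j => p.1.2 j) (Matrix.of fun _ j => p.1.2 j).conjTranspose
        ((Matrix.of fun i j => starRingEnd ℂ (p.1.2 i) * p.1.2 j / p.1.1) + hermOf p.2) := by
  ext (_ | i) (_ | j)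
  · simp [headEquiv, hermOf_schurEquiv_zero_zero]
  · simp [headEquiv, hermOf_schurEquiv_zero_succ]
  · simp [headEquiv, hermOf_schurEquiv_succ_zero]
  · simp [headEquiv, hermOf_schurEquiv_succ_succ]

theorem schur_complement_rankOne {n : ℕ} {d : ℝ} (b : Fin n → ℂ)
    (A : Matrix (Fin n) (Fin n) ℂ) :
    (Matrix.of fun i j => starRingEnd ℂ (b i) * b j / d) + A -
      (Matrix.of fun (_ : Unit) j => b j).conjTranspose *
        (Matrix.diagonal fun _ : Unit => (d : ℂ))⁻¹ * (Matrix.of fun (_ : Unit) j => b j) = A := by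
  ext i j
  simp [Matrix.mul_apply, Ring.inverse_eq_inv', div_eq_mul_inv]
  ring

theorem det_hermOf_schurEquiv {n : ℕ} (p : (ℝ × (Fin n → ℂ)) × HermCoord n) (hd : p.1.1 ≠ 0) :
    (hermOf (schurEquiv n p)).det = p.1.1 * (hermOf p.2).det := by
  have hdet : IsUnit (Matrix.diagonal fun _ : Unit => (p.1.1 : ℂ)).det := by
    simpa using hd
  let _ := (Matrix.diagonal fun _ : Unit => (p.1.1 : ℂ)).invertibleOfIsUnitDet hdet
  rw [← Matrix.det_submatrix_equiv_self (headEquiv n), hermOf_schurEquiv_submatrix,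
    Matrix.det_fromBlocks₁₁, Matrix.invOf_eq_nonsing_inv, schur_complement_rankOne]
  simp

open scoped ComplexOrder in
/-- A Hermitian matrix is positive definite if and only if its first diagonal entry is positive and
the Schur complement of that entry is positive definite. -/
theorem schurEquiv_mem_posCone {n : ℕ} (p : (ℝ × (Fin n → ℂ)) × HermCoord n) :
    schurEquiv n p ∈ posCone (n + 1) ↔ 0 < p.1.1 ∧ p.2 ∈ posCone n := by
  have key (hd : 0 < p.1.1) : (hermOf (schurEquiv n p)).PosDef ↔ (hermOf p.2).PosDef := by
    have hD : (Matrix.diagonal fun _ : Unit => (p.1.1 : ℂ)).PosDef :=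
      Matrix.PosDef.diagonal fun _ => by exact_mod_cast hd
    have hdet : IsUnit (Matrix.diagonal fun _ : Unit => (p.1.1 : ℂ)).det := by
      simpa using hd.ne'
    let _ := (Matrix.diagonal fun _ : Unit => (p.1.1 : ℂ)).invertibleOfIsUnitDet hdet
    have hps : (hermOf (schurEquiv n p)).PosSemidef ↔ (hermOf p.2).PosSemidef := by
      rw [← Matrix.posSemidef_submatrix_equiv (headEquiv n), hermOf_schurEquiv_submatrix,
        Matrix.PosDef.fromBlocks₁₁ _ _ hD, schur_complement_rankOne]
    constructor
    · intro h
      rw [(hps.mp h.posSemidef).posDef_iff_det_ne_zero]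
      have := h.det_pos.ne'
      rw [det_hermOf_schurEquiv _ hd.ne'] at this
      exact right_ne_zero_of_mul this
    · intro h
      rw [(hps.mpr h.posSemidef).posDef_iff_det_ne_zero, det_hermOf_schurEquiv _ hd.ne']
      exact mul_ne_zero (by exact_mod_cast hd.ne') h.det_pos.ne'
  constructor
  · intro h
    have hd : 0 < p.1.1 := by
      have := (show (hermOf (schurEquiv n p)).PosDef from h).diag_pos (i := 0)
      rw [hermOf_schurEquiv_zero_zero] at this
      exact_mod_cast this
    exact ⟨hd, (key hd).mp h⟩
  · rintro ⟨hd, h⟩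
    exact (key hd).mpr h

open scoped ComplexOrder in
theorem posCone_zero : posCone 0 = Set.univ := by
  ext c
  simp only [Set.mem_univ, iff_true]
  have : (1 : Matrix (Fin 0) (Fin 0) ℂ).PosDef := Matrix.PosDef.one
  rwa [Subsingleton.elim (1 : Matrix (Fin 0) (Fin 0) ℂ) (hermOf c)] at this

/-- By induction on the size, as the Schur complement is continuous where the first diagonal entry
is positive. -/
theorem isOpen_posCone (n : ℕ) : IsOpen (posCone n) := by
  induction n with
  | zero =>
    rw [posCone_zero]
    exact isOpen_univ
  | succ n ih =>
    have hset : posCone (n + 1) = {c : HermCoord (n + 1) | 0 < c.1 0} ∩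
        (fun c => ((schurEquiv n).symm c).2) ⁻¹' posCone n := by
      ext c
      obtain ⟨p, rfl⟩ := (schurEquiv n).surjective c
      rw [schurEquiv_mem_posCone]
      rw [Set.mem_inter_iff, Set.mem_preimage, MeasurableEquiv.symm_apply_apply]
      rfl
    have hopen : IsOpen {c : HermCoord (n + 1) | 0 < c.1 0} :=
      isOpen_lt continuous_const (by fun_prop)
    rw [hset]
    refine ContinuousOn.isOpen_inter_preimage ?_ hopen ih
    have hcont : ContinuousOn (fun c : HermCoord (n + 1) =>
        -(rankOneCoord (c.1 0, fun j => c.2 (upperEquiv n (Sum.inl j))) : HermCoord n)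
        + (fun i => c.1 i.succ, fun q => c.2 (upperEquiv n (Sum.inr q))))
        {c | 0 < c.1 0} := by
      refine ContinuousOn.add (ContinuousOn.neg (ContinuousOn.prodMk ?_ ?_)) (by fun_prop)
      · refine continuousOn_pi.mpr fun i => ?_
        refine ContinuousOn.div (by fun_prop) (by fun_prop) fun c hc => (ne_of_gt hc)
      · refine continuousOn_pi.mpr fun q => ?_
        refine ContinuousOn.div ?_ ?_ fun c hc => by exact_mod_cast (ne_of_gt hc)
        · refine Continuous.continuousOn ?_
          exact (Complex.continuous_conj.comp (by fun_prop)).mul (by fun_prop)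
        · exact (Complex.continuous_ofReal.comp (by fun_prop)).continuousOn
    exact hcont

theorem measurableSet_posCone (n : ℕ) : MeasurableSet (posCone n) :=
  (isOpen_posCone n).measurableSet

open scoped ComplexOrder in
theorem det_pos_of_mem {n : ℕ} {c : HermCoord n} (hc : c ∈ posCone n) :
    0 < (hermOf c).det.re ∧ (hermOf c).det = ((hermOf c).det.re : ℂ) := by
  have h : (0 : ℂ) < (hermOf c).det := Matrix.PosDef.det_pos hc
  rw [Complex.lt_def] at h
  exact ⟨h.1, Complex.ext rfl (by simpa using h.2.symm)⟩

/-! ### The Laguerre weight: integrability and normalization -/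

/-- The weight `(det M)^α exp(-c tr M)`. -/
noncomputable def laguerreWeight {n : ℕ} (α : ℂ) (c : ℝ) (M : Matrix (Fin n) (Fin n) ℂ) : ℂ :=
  M.det ^ α * Complex.exp (-(c * M.trace))

/-- The factor of the Laguerre weight that depends on the first row `(d, b)`. -/
noncomputable def rowWeight {n : ℕ} (α : ℂ) (c : ℝ) (p : ℝ × (Fin n → ℂ)) : ℂ :=
  (p.1 : ℂ) ^ α * Complex.exp (-(c * p.1)) * ∏ i, Complex.exp (-(c / p.1 : ℝ) * (‖p.2 i‖ : ℂ) ^ 2)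

theorem laguerreWeight_schurEquiv {n : ℕ} (α : ℂ) (c : ℝ) {p : (ℝ × (Fin n → ℂ)) × HermCoord n}
    (hd : 0 < p.1.1) (hA : p.2 ∈ posCone n) :
    laguerreWeight α c (hermOf (schurEquiv n p)) =
      rowWeight α c p.1 * laguerreWeight α c (hermOf p.2) := by
  obtain ⟨h1, h2⟩ := det_pos_of_mem hA
  rw [laguerreWeight, laguerreWeight, rowWeight, det_hermOf_schurEquiv _ hd.ne',
    trace_hermOf_schurEquiv, h2, Complex.mul_cpow_ofReal_nonneg hd.le h1.le, ← Complex.exp_sum,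
    ← Finset.mul_sum]
  have : Complex.exp (-(c * (p.1.1 + (∑ i, (‖p.1.2 i‖ : ℂ) ^ 2) / p.1.1 + (hermOf p.2).trace))) =
      Complex.exp (-(c * p.1.1)) * Complex.exp (-(c / p.1.1 : ℝ) * ∑ i, (‖p.1.2 i‖ : ℂ) ^ 2) *
        Complex.exp (-(c * (hermOf p.2).trace)) := by
    rw [← Complex.exp_add, ← Complex.exp_add]
    congr 1
    push_cast
    ring
  rw [this]
  ring

theorem integrable_gaussian_complex_pi (n : ℕ) {t : ℝ} (ht : 0 < t) :
    Integrable fun b : Fin n → ℂ => ∏ i, Complex.exp (-(t : ℝ) * (‖b i‖ : ℂ) ^ 2) := by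
  refine Integrable.fintype_prod (f := fun _ (z : ℂ) => Complex.exp (-(t : ℝ) * (‖z‖ : ℂ) ^ 2))
    fun _ => ?_
  simpa using GaussianFourier.integrable_cexp_neg_mul_sq_norm_add (V := ℂ) (b := (t : ℂ))
    (by simpa using ht) 0 0

theorem integral_gaussian_complex_pi (n : ℕ) {t : ℝ} (ht : 0 < t) :
    ∫ b : Fin n → ℂ, ∏ i, Complex.exp (-(t : ℝ) * (‖b i‖ : ℂ) ^ 2) = (Real.pi / t) ^ n := by
  have h := integral_fintype_prod_volume_eq_pow (ι := Fin n)
    (fun z : ℂ => Complex.exp (-(t : ℝ) * (‖z‖ : ℂ) ^ 2))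
  rw [h, GaussianFourier.integral_cexp_neg_mul_sq_norm (V := ℂ) (b := (t : ℂ)) (by simpa using ht)]
  simp [Complex.finrank_real_complex]

theorem measurable_rowWeight {n : ℕ} (α : ℂ) (c : ℝ) :
    Measurable (rowWeight α c : ℝ × (Fin n → ℂ) → ℂ) := by
  unfold rowWeight
  refine Measurable.mul (Measurable.mul ?_ ?_) (Finset.measurable_prod _ fun i _ => ?_)
  · exact (Complex.measurable_ofReal.comp measurable_fst).pow_const α
  · fun_prop
  · fun_prop

theorem norm_rowWeight {n : ℕ} (α : ℂ) (c : ℝ) {p : ℝ × (Fin n → ℂ)} (hp : 0 < p.1) :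
    (‖rowWeight α c p‖ : ℂ) = rowWeight α.re c p := by
  have hexp (r : ℝ) : (‖Complex.exp (r : ℂ)‖ : ℂ) = Complex.exp (r : ℂ) := by
    rw [Complex.norm_exp_ofReal, Complex.ofReal_exp]
  simp only [rowWeight, norm_mul, norm_prod, Complex.ofReal_mul, Complex.ofReal_prod]
  rw [Complex.norm_cpow_eq_rpow_re_of_pos hp, Complex.ofReal_cpow hp.le]
  refine congrArg₂ (· * ·) (congrArg₂ (· * ·) rfl ?_) ?_
  · simpa using hexp (-(c * p.1))
  · refine Finset.prod_congr rfl fun i _ => ?_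
    have := hexp (-(c / p.1) * ‖p.2 i‖ ^ 2)
    push_cast at this ⊢
    exact this

theorem integral_rowWeight_right {n : ℕ} (α : ℂ) {c d : ℝ} (hc : 0 < c) (hd : 0 < d) :
    ∫ b : Fin n → ℂ, rowWeight α c (d, b) =
      (Real.pi / c) ^ n * ((d : ℂ) ^ (α + n + 1 - 1) * Complex.exp (-(c * d))) := by
  simp only [rowWeight]
  rw [integral_const_mul, integral_gaussian_complex_pi n (div_pos hc hd)]
  have : (d : ℂ) ≠ 0 := by exact_mod_cast hd.ne'
  have : (c : ℂ) ≠ 0 := by exact_mod_cast hc.ne'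
  rw [add_sub_cancel_right, Complex.cpow_add _ _ (by assumption), Complex.cpow_natCast]
  have h : (Real.pi : ℂ) / (c / d : ℝ) = d * (Real.pi / c) := by
    push_cast
    field_simp
  rw [h, mul_pow]
  ring

theorem integrableOn_rowWeight (n : ℕ) {α : ℂ} (hα : -1 < α.re) {c : ℝ} (hc : 0 < c) :
    IntegrableOn (rowWeight α c : ℝ × (Fin n → ℂ) → ℂ) (Set.Ioi 0 ×ˢ Set.univ) := by
  rw [IntegrableOn, Measure.volume_eq_prod, ← Measure.prod_restrict, Measure.restrict_univ,
    integrable_prod_iff (measurable_rowWeight α c).aestronglyMeasurable]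
  constructor
  · filter_upwards [ae_restrict_mem measurableSet_Ioi] with d hd
    exact (integrable_gaussian_complex_pi n (div_pos hc hd)).const_mul
      ((d : ℂ) ^ α * Complex.exp (-(c * d)))
  · have hint : IntegrableOn (fun d : ℝ =>
        (Real.pi / c) ^ n * (d ^ (α.re + n) * Real.exp (-c * d ^ (1 : ℝ)))) (Set.Ioi 0) := by
      refine Integrable.const_mul (integrableOn_rpow_mul_exp_neg_mul_rpow ?_ one_pos hc) _
      have : (0 : ℝ) ≤ n := n.cast_nonneg
      linarith
    refine hint.congr ?_
    filter_upwards [ae_restrict_mem measurableSet_Ioi] with d hd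
    have hd' : 0 < d := hd
    have : ((∫ b : Fin n → ℂ, ‖rowWeight α c (d, b)‖ : ℝ) : ℂ) =
        (((Real.pi / c) ^ n * (d ^ (α.re + n) * Real.exp (-c * d ^ (1 : ℝ))) : ℝ) : ℂ) := by
      have h2 (b : Fin n → ℂ) : ((‖rowWeight α c (d, b)‖ : ℝ) : ℂ) = rowWeight α.re c (d, b) :=
        norm_rowWeight α c (p := (d, b)) hd'
      rw [← integral_complex_ofReal]
      simp only [h2]
      rw [integral_rowWeight_right _ hc hd', add_sub_cancel_right]
      push_cast
      rw [Complex.ofReal_cpow hd'.le, Real.rpow_one]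
      push_cast
      ring_nf
    exact_mod_cast this.symm

theorem integral_rowWeight (n : ℕ) {α : ℂ} (hα : -1 < α.re) {c : ℝ} (hc : 0 < c) :
    ∫ p in Set.Ioi 0 ×ˢ Set.univ, (rowWeight α c : ℝ × (Fin n → ℂ) → ℂ) p =
      (Real.pi / c) ^ n * ((1 / c) ^ (α + n + 1) * Complex.Gamma (α + n + 1)) := by
  have h := setIntegral_prod _ (integrableOn_rowWeight n hα hc)
  rw [Measure.volume_eq_prod, h, Measure.restrict_univ,
    setIntegral_congr_fun measurableSet_Ioi fun d hd => integral_rowWeight_right α hc hd,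
    integral_const_mul, Complex.integral_cpow_mul_exp_neg_mul_Ioi _ hc]
  have : (0 : ℝ) ≤ n := n.cast_nonneg
  simp
  linarith

theorem schurEquiv_preimage_posCone (n : ℕ) :
    schurEquiv n ⁻¹' posCone (n + 1) = (Set.Ioi 0 ×ˢ Set.univ) ×ˢ posCone n := by
  ext p
  rw [Set.mem_preimage, schurEquiv_mem_posCone]
  simp

theorem volume_hermCoord_zero : (volume : Measure (HermCoord 0)) = Measure.dirac 0 := by
  rw [Measure.volume_eq_prod, volume_pi, volume_pi, Measure.pi_of_empty (x := 0),
    Measure.pi_of_empty (x := 0), Measure.dirac_prod_dirac]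
  rfl

theorem laguerreWeight_zero (α : ℂ) (c : ℝ) (M : Matrix (Fin 0) (Fin 0) ℂ) :
    laguerreWeight α c M = 1 := by
  simp [laguerreWeight]

theorem integrableOn_laguerreWeight (n : ℕ) {α : ℂ} (hα : -1 < α.re) {c : ℝ} (hc : 0 < c) :
    IntegrableOn (fun x : HermCoord n => laguerreWeight α c (hermOf x)) (posCone n) := by
  induction n with
  | zero =>
    simp only [laguerreWeight_zero, posCone_zero, volume_hermCoord_zero]
    exact (integrable_const 1).integrableOn
  | succ n ih =>
    rw [← (measurePreserving_schurEquiv n).integrableOn_comp_preimage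
      (schurEquiv n).measurableEmbedding, schurEquiv_preimage_posCone]
    have h := (integrableOn_rowWeight n hα hc).mul_prod ih
    rw [Measure.prod_restrict] at h
    refine IntegrableOn.congr_fun h ?_ ?_
    · rintro p ⟨⟨hd, -⟩, hA⟩
      exact (laguerreWeight_schurEquiv α c hd hA).symm
    · exact (measurableSet_Ioi.prod MeasurableSet.univ).prod (measurableSet_posCone n)

/-- The total mass of the Laguerre weight, by induction on the size: the first row contributes the
factor `π ^ n * c ^ (-(α + 2 n + 1)) * Γ(α + n + 1)`. -/
theorem integral_laguerreWeight (n : ℕ) {α : ℂ} (hα : -1 < α.re) {c : ℝ} (hc : 0 < c) :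
    ∫ x in posCone n, laguerreWeight α c (hermOf x) =
      (Real.pi : ℂ) ^ (n * (n - 1) / 2) * (1 / c) ^ ((n : ℂ) ^ 2 + α * n) *
        ∏ j ∈ Finset.range n, Complex.Gamma (α + 1 + j) := by
  induction n with
  | zero =>
    simp [laguerreWeight_zero, posCone_zero, volume_hermCoord_zero]
  | succ n ih =>
    rw [← (measurePreserving_schurEquiv n).setIntegral_preimage_emb
      (schurEquiv n).measurableEmbedding, schurEquiv_preimage_posCone,
      setIntegral_congr_fun ((measurableSet_Ioi.prod MeasurableSet.univ).prod
        (measurableSet_posCone n)) (fun p hp =>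
          laguerreWeight_schurEquiv (p := p) α c hp.1.1 hp.2)]
    have h := setIntegral_prod_mul (μ := volume) (ν := volume) (rowWeight (n := n) α c)
      (fun x : HermCoord n => laguerreWeight α c (hermOf x)) (Set.Ioi 0 ×ˢ Set.univ) (posCone n)
    rw [Measure.volume_eq_prod, h, ih, integral_rowWeight n hα hc, Finset.prod_range_succ]
    have hpi : (n + 1) * (n + 1 - 1) / 2 = n + n * (n - 1) / 2 := by
      rcases n with _ | n
      · rfl
      · simp only [Nat.add_sub_cancel]
        have : (n + 1 + 1) * (n + 1) = 2 * (n + 1) + (n + 1) * n := by ring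
        rw [this, Nat.mul_add_div (by norm_num)]
    have hc0 : (1 / c : ℂ) ≠ 0 := one_div_ne_zero (by exact_mod_cast hc.ne')
    have hpow : (1 / c : ℂ) ^ (((n + 1 : ℕ) : ℂ) ^ 2 + α * (n + 1 : ℕ)) =
        (1 / c : ℂ) ^ n * (1 / c : ℂ) ^ (α + n + 1) * (1 / c : ℂ) ^ ((n : ℂ) ^ 2 + α * n) := by
      rw [← Complex.cpow_natCast (1 / c : ℂ) n, ← Complex.cpow_add _ _ hc0,
        ← Complex.cpow_add _ _ hc0]
      congr 1
      push_cast
      ring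
    rw [hpi, hpow, pow_add, div_eq_mul_one_div, mul_pow]
    have : α + n + 1 = α + 1 + n := by ring
    rw [this]
    ring

/-! ### Functions of subexponential growth on the cone -/

open scoped ComplexOrder in
/-- A continuous function on matrices is tame if, on positive definite matrices, it grows more
slowly than every exponential of the trace. Polynomials in the entries are tame. -/
def Tame {n : ℕ} (Q : Matrix (Fin n) (Fin n) ℂ → ℂ) : Prop :=
  Continuous Q ∧ ∀ s : ℝ, 0 < s → ∃ C : ℝ, ∀ M : Matrix (Fin n) (Fin n) ℂ, M.PosDef →
    ‖Q M‖ ≤ C * Real.exp (s * M.trace.re)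

section Tame

variable {n : ℕ} {P Q : Matrix (Fin n) (Fin n) ℂ → ℂ}

open scoped ComplexOrder in
theorem trace_re_nonneg {M : Matrix (Fin n) (Fin n) ℂ} (hM : M.PosDef) : 0 ≤ M.trace.re :=
  (Complex.le_def.mp hM.posSemidef.trace_nonneg).1

theorem tame_const (z : ℂ) : Tame fun _ : Matrix (Fin n) (Fin n) ℂ => z := by
  refine ⟨continuous_const, fun s hs => ⟨‖z‖, fun M hM => ?_⟩⟩
  have := Real.one_le_exp (mul_nonneg hs.le (trace_re_nonneg hM))
  nlinarith [norm_nonneg z]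

theorem Tame.add (hP : Tame P) (hQ : Tame Q) : Tame fun M => P M + Q M := by
  refine ⟨hP.1.add hQ.1, fun s hs => ?_⟩
  obtain ⟨C, hC⟩ := hP.2 s hs
  obtain ⟨D, hD⟩ := hQ.2 s hs
  refine ⟨C + D, fun M hM => (norm_add_le _ _).trans ?_⟩
  rw [add_mul]
  exact add_le_add (hC M hM) (hD M hM)

theorem Tame.mul (hP : Tame P) (hQ : Tame Q) : Tame fun M => P M * Q M := by
  refine ⟨hP.1.mul hQ.1, fun s hs => ?_⟩
  obtain ⟨C, hC⟩ := hP.2 (s / 2) (half_pos hs)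
  obtain ⟨D, hD⟩ := hQ.2 (s / 2) (half_pos hs)
  refine ⟨C * D, fun M hM => (norm_mul_le _ _).trans ?_⟩
  have h := mul_le_mul (hC M hM) (hD M hM) (norm_nonneg _) ((norm_nonneg _).trans (hC M hM))
  have hexp : Real.exp (s * M.trace.re) =
      Real.exp (s / 2 * M.trace.re) * Real.exp (s / 2 * M.trace.re) := by
    rw [← Real.exp_add]
    ring_nf
  rw [hexp]
  linarith

theorem Tame.sum {ι : Type*} {f : ι → Matrix (Fin n) (Fin n) ℂ → ℂ} (S : Finset ι)
    (hf : ∀ i ∈ S, Tame (f i)) : Tame fun M => ∑ i ∈ S, f i M := by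
  classical
  induction S using Finset.induction_on with
  | empty => simpa using tame_const 0
  | insert i S hi ih =>
    simp only [Finset.sum_insert hi]
    exact (hf i (Finset.mem_insert_self i S)).add
      (ih fun j hj => hf j (Finset.mem_insert_of_mem hj))

theorem Tame.prod {ι : Type*} {f : ι → Matrix (Fin n) (Fin n) ℂ → ℂ} (S : Finset ι)
    (hf : ∀ i ∈ S, Tame (f i)) : Tame fun M => ∏ i ∈ S, f i M := by
  classical
  induction S using Finset.induction_on with
  | empty => simpa using tame_const 1
  | insert i S hi ih =>
    simp only [Finset.prod_insert hi]
    exact (hf i (Finset.mem_insert_self i S)).mul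
      (ih fun j hj => hf j (Finset.mem_insert_of_mem hj))

theorem Tame.pow (hP : Tame P) (m : ℕ) : Tame fun M => P M ^ m := by
  simpa using Tame.prod (f := fun _ => P) (Finset.range m) fun _ _ => hP

open scoped ComplexOrder MatrixOrder Matrix.Norms.L2Operator in
/-- With `M = B* B`, the entry `M i j` is the inner product of two columns of `B`, and the trace is
the sum of the squared norms of all columns. -/
theorem norm_entry_le_trace {M : Matrix (Fin n) (Fin n) ℂ} (hM : M.PosDef) (i j : Fin n) :
    ‖M i j‖ ≤ M.trace.re := by
  obtain ⟨B, rfl⟩ := CStarAlgebra.nonneg_iff_eq_star_mul_self.mp hM.posSemidef.nonneg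
  rw [Matrix.star_eq_conjTranspose]
  have htr : (B.conjTranspose * B).trace.re = ∑ k, ∑ l, ‖B k l‖ ^ 2 := by
    rw [Finset.sum_comm]
    simp only [Matrix.trace, Matrix.diag, Matrix.mul_apply, Matrix.conjTranspose_apply,
      Complex.re_sum]
    refine Finset.sum_congr rfl fun l _ => Finset.sum_congr rfl fun k _ => ?_
    rw [RCLike.star_def, Complex.conj_mul']
    norm_cast
  rw [htr, Matrix.mul_apply]
  refine (norm_sum_le _ _).trans (Finset.sum_le_sum fun k _ => ?_)
  rw [norm_mul, Matrix.conjTranspose_apply, norm_star]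
  have h (l : Fin n) : ‖B k l‖ ^ 2 ≤ ∑ l, ‖B k l‖ ^ 2 :=
    Finset.single_le_sum (f := fun l => ‖B k l‖ ^ 2) (fun _ _ => by positivity)
      (Finset.mem_univ l)
  nlinarith [h i, h j, sq_nonneg (‖B k i‖ - ‖B k j‖)]

theorem tame_entry (i j : Fin n) : Tame fun M : Matrix (Fin n) (Fin n) ℂ => M i j := by
  refine ⟨by fun_prop, fun s hs => ⟨1 / s, fun M hM => (norm_entry_le_trace hM i j).trans ?_⟩⟩
  have := Real.add_one_le_exp (s * M.trace.re)
  rw [div_mul_eq_mul_div, one_mul, le_div_iff₀ hs]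
  linarith

theorem tame_mul_entry {A B : Matrix (Fin n) (Fin n) ℂ → Matrix (Fin n) (Fin n) ℂ}
    (hA : ∀ i j, Tame fun M => A M i j) (hB : ∀ i j, Tame fun M => B M i j) (i j : Fin n) :
    Tame fun M => (A M * B M) i j := by
  simp only [Matrix.mul_apply]
  exact Tame.sum _ fun k _ => (hA i k).mul (hB k j)

theorem tame_pow_entry (m : ℕ) (i j : Fin n) :
    Tame fun M : Matrix (Fin n) (Fin n) ℂ => (M ^ m) i j := by
  induction m generalizing i j with
  | zero => simpa using tame_const _
  | succ m ih =>
    simp only [pow_succ]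
    exact tame_mul_entry ih tame_entry i j

theorem tame_trace {A : Matrix (Fin n) (Fin n) ℂ → Matrix (Fin n) (Fin n) ℂ}
    (hA : ∀ i j, Tame fun M => A M i j) : Tame fun M => (A M).trace :=
  Tame.sum _ fun i _ => hA i i

theorem tame_adjugate_entry (i j : Fin n) :
    Tame fun M : Matrix (Fin n) (Fin n) ℂ => M.adjugate i j := by
  simp only [Matrix.adjugate_apply, Matrix.det_apply']
  refine Tame.sum _ fun σ _ => (tame_const _).mul (Tame.prod _ fun k _ => ?_)
  simp only [Matrix.updateRow_apply]
  split_ifs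
  · exact tame_const _
  · exact tame_entry _ _

theorem continuous_hermOf : Continuous (hermOf : HermCoord n → Matrix (Fin n) (Fin n) ℂ) := by
  refine continuous_matrix fun i j => ?_
  rcases lt_trichotomy i j with h | h | h
  · simp only [hermOf, Matrix.of_apply, h, dif_pos]
    fun_prop
  · subst h
    simp only [hermOf, Matrix.of_apply, lt_irrefl, dif_neg, not_false_eq_true]
    exact Complex.continuous_ofReal.comp (by fun_prop)
  · simp only [hermOf, Matrix.of_apply, h, h.not_gt, dif_pos, dif_neg, not_false_eq_true]
    exact Complex.continuous_conj.comp (by fun_prop)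

theorem measurable_laguerreWeight (α : ℂ) (c : ℝ) :
    Measurable fun x : HermCoord n => laguerreWeight α c (hermOf x) := by
  have h1 : Continuous fun x : HermCoord n => (hermOf x).det := continuous_hermOf.matrix_det
  have h2 : Continuous fun x : HermCoord n => (hermOf x).trace := continuous_hermOf.matrix_trace
  exact (h1.measurable.pow_const α).mul
    (Complex.continuous_exp.comp (h2.const_mul (c : ℂ)).neg).measurable

theorem norm_laguerreWeight (α : ℂ) (c : ℝ) (M : Matrix (Fin n) (Fin n) ℂ) :
    ‖laguerreWeight α c M‖ = ‖M.det ^ α‖ * Real.exp (-(c * M.trace.re)) := by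
  rw [laguerreWeight, norm_mul, Complex.norm_exp]
  simp

/-- Tame functions are integrable against the Laguerre weight: their growth is absorbed by half of
the exponential factor. -/
theorem Tame.integrableOn (hQ : Tame Q) {α : ℂ} (hα : -1 < α.re) {c : ℝ} (hc : 0 < c)
    {u : HermCoord n → ℂ} (hu : Measurable u) {B : ℝ} (hB : ∀ x ∈ posCone n, ‖u x‖ ≤ B) :
    IntegrableOn (fun x : HermCoord n =>
      laguerreWeight α c (hermOf x) * (u x * Q (hermOf x))) (posCone n) := by
  obtain ⟨C, hC⟩ := hQ.2 (c / 2) (half_pos hc)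
  have h := (integrableOn_laguerreWeight n hα (half_pos hc)).norm.const_mul (B * C)
  refine Integrable.mono' h ((measurable_laguerreWeight α c).mul
    (hu.mul (hQ.1.comp continuous_hermOf).measurable)).aestronglyMeasurable ?_
  filter_upwards [ae_restrict_mem (measurableSet_posCone n)] with x hx
  rw [norm_mul, norm_mul, norm_laguerreWeight, norm_laguerreWeight]
  have h1 := mul_le_mul (hB x hx) (hC _ hx) (norm_nonneg _) ((norm_nonneg _).trans (hB x hx))
  have hexp : Real.exp (-(c / 2 * (hermOf x).trace.re)) =
      Real.exp (-(c * (hermOf x).trace.re)) * Real.exp (c / 2 * (hermOf x).trace.re) := by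
    rw [← Real.exp_add]
    ring_nf
  rw [hexp]
  calc _ ≤ ‖(hermOf x).det ^ α‖ * Real.exp (-(c * (hermOf x).trace.re)) *
        (B * (C * Real.exp (c / 2 * (hermOf x).trace.re))) :=
        mul_le_mul_of_nonneg_left h1 (by positivity)
    _ = _ := by ring

theorem Tame.integrableOn_mul (hQ : Tame Q) {α : ℂ} (hα : -1 < α.re) {c : ℝ} (hc : 0 < c) :
    IntegrableOn (fun x : HermCoord n => laguerreWeight α c (hermOf x) * Q (hermOf x))
      (posCone n) := by
  simpa using hQ.integrableOn hα hc (u := fun _ => 1) measurable_const (B := 1) (by simp)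

end Tame

/-! ### Differentiation of polynomial functions of a matrix -/

/-- `Q` is tame and differentiable along lines, and its derivative `DQ M H` at `M` in the direction
`H`, which is complex linear in `H`, is tame in `M`. -/
structure HasTameDeriv {n : ℕ} (Q : Matrix (Fin n) (Fin n) ℂ → ℂ)
    (DQ : Matrix (Fin n) (Fin n) ℂ → Matrix (Fin n) (Fin n) ℂ →ₗ[ℂ] ℂ) : Prop where
  tame : Tame Q
  tame_deriv : ∀ H, Tame fun M => DQ M H
  hasDerivAt : ∀ M H, HasDerivAt (fun t : ℝ => Q (M + (t : ℂ) • H)) (DQ M H) 0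

section Derivatives

variable {n : ℕ} {P Q : Matrix (Fin n) (Fin n) ℂ → ℂ}
  {DP DQ : Matrix (Fin n) (Fin n) ℂ → Matrix (Fin n) (Fin n) ℂ →ₗ[ℂ] ℂ}

theorem HasTameDeriv.mul (hP : HasTameDeriv P DP) (hQ : HasTameDeriv Q DQ) :
    HasTameDeriv (fun M => P M * Q M) fun M => Q M • DP M + P M • DQ M where
  tame := hP.tame.mul hQ.tame
  tame_deriv H := (hQ.tame.mul (hP.tame_deriv H)).add (hP.tame.mul (hQ.tame_deriv H))
  hasDerivAt M H := by
    refine ((hP.hasDerivAt M H).mul (hQ.hasDerivAt M H)).congr_deriv ?_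
    simp
    ring

/-- The derivative `H ↦ ∑ a, M ^ a * H * M ^ (m - 1 - a)` of `M ↦ M ^ m`. -/
noncomputable def powDeriv (m : ℕ) (M : Matrix (Fin n) (Fin n) ℂ) :
    Matrix (Fin n) (Fin n) ℂ →ₗ[ℂ] Matrix (Fin n) (Fin n) ℂ :=
  ∑ a ∈ Finset.range m, LinearMap.mulLeft ℂ (M ^ a) ∘ₗ LinearMap.mulRight ℂ (M ^ (m - 1 - a))

theorem powDeriv_apply (m : ℕ) (M H : Matrix (Fin n) (Fin n) ℂ) :
    powDeriv m M H = ∑ a ∈ Finset.range m, M ^ a * (H * M ^ (m - 1 - a)) := by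
  simp [powDeriv]

theorem powDeriv_succ (m : ℕ) (M H : Matrix (Fin n) (Fin n) ℂ) :
    powDeriv (m + 1) M H = powDeriv m M H * M + M ^ m * H := by
  rw [powDeriv_apply, powDeriv_apply, Finset.sum_range_succ, Finset.sum_mul]
  congr 1
  · refine Finset.sum_congr rfl fun a ha => ?_
    have : m + 1 - 1 - a = m - 1 - a + 1 := by
      have := Finset.mem_range.mp ha
      omega
    rw [this, pow_succ]
    simp only [mul_assoc]
  · simp

theorem hasDerivAt_pow_entry (m : ℕ) (M H : Matrix (Fin n) (Fin n) ℂ) (i j : Fin n) :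
    HasDerivAt (fun t : ℝ => ((M + (t : ℂ) • H) ^ m) i j) (powDeriv m M H i j) 0 := by
  induction m generalizing i j with
  | zero => simpa [powDeriv_apply] using hasDerivAt_const (0 : ℝ) _
  | succ m ih =>
    simp only [pow_succ, Matrix.mul_apply]
    have hlin (k l : Fin n) :
        HasDerivAt (fun t : ℝ => (M + (t : ℂ) • H) k l) (H k l) 0 := by
      simp only [Matrix.add_apply, Matrix.smul_apply, smul_eq_mul]
      simpa using ((hasDerivAt_id (0 : ℝ)).ofReal_comp.mul_const (H k l)).const_add (M k l)
    refine (HasDerivAt.fun_sum fun k _ => (ih i k).mul (hlin k j)).congr_deriv ?_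
    rw [powDeriv_succ, Matrix.add_apply, Matrix.mul_apply, Matrix.mul_apply,
      ← Finset.sum_add_distrib]
    simp

theorem hasTameDeriv_pow_entry (m : ℕ) (i j : Fin n) :
    HasTameDeriv (fun M : Matrix (Fin n) (Fin n) ℂ => (M ^ m) i j)
      fun M => Matrix.entryLinearMap ℂ ℂ i j ∘ₗ powDeriv m M where
  tame := tame_pow_entry m i j
  tame_deriv H := by
    simp only [LinearMap.comp_apply, Matrix.entryLinearMap_apply, powDeriv_apply, Matrix.sum_apply]
    exact Tame.sum _ fun a _ => tame_mul_entry (A := fun M => M ^ a)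
      (B := fun M => H * M ^ (m - 1 - a)) (tame_pow_entry a)
      (tame_mul_entry (A := fun _ => H) (B := fun M => M ^ (m - 1 - a))
        (fun _ _ => tame_const _) (tame_pow_entry _)) i j
  hasDerivAt M H := hasDerivAt_pow_entry m M H i j

theorem trace_powDeriv (m : ℕ) (M H : Matrix (Fin n) (Fin n) ℂ) :
    (powDeriv m M H).trace = m * (M ^ (m - 1) * H).trace := by
  rw [powDeriv_apply, Matrix.trace_sum,
    Finset.sum_congr rfl (g := fun _ => (M ^ (m - 1) * H).trace)]
  · simp
  · intro a ha
    have : m - 1 = m - 1 - a + a := by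
      have := Finset.mem_range.mp ha
      omega
    rw [Matrix.trace_mul_comm, mul_assoc, ← pow_add, ← this, Matrix.trace_mul_comm]

theorem hasDerivAt_trace_pow (m : ℕ) (M H : Matrix (Fin n) (Fin n) ℂ) :
    HasDerivAt (fun t : ℝ => ((M + (t : ℂ) • H) ^ m).trace) (m * (M ^ (m - 1) * H).trace) 0 := by
  rw [← trace_powDeriv]
  exact HasDerivAt.fun_sum fun i _ => hasDerivAt_pow_entry m M H i i

/-- Jacobi's formula at an invertible matrix. -/
theorem hasDerivAt_det {M : Matrix (Fin n) (Fin n) ℂ} (hM : IsUnit M.det)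
    (H : Matrix (Fin n) (Fin n) ℂ) :
    HasDerivAt (fun t : ℝ => (M + (t : ℂ) • H).det) (M.adjugate * H).trace 0 := by
  have h1 (t : ℝ) : (M + (t : ℂ) • H).det = M.det * (1 + (M⁻¹ * H).trace * t +
      (((1 + (Polynomial.X : Polynomial ℂ) • (M⁻¹ * H).map Polynomial.C).det).divX.divX.eval
        (t : ℂ)) * (t : ℂ) ^ 2) := by
    rw [← Matrix.det_one_add_smul, ← Matrix.det_mul, mul_add, mul_one, Matrix.mul_smul,
      ← mul_assoc, Matrix.mul_nonsing_inv _ hM, one_mul]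
  generalize ((1 + (Polynomial.X : Polynomial ℂ) • (M⁻¹ * H).map Polynomial.C).det).divX.divX = p
    at h1
  simp only [h1]
  have hid : HasDerivAt (fun t : ℝ => (t : ℂ)) 1 0 := by
    simpa using (hasDerivAt_id (0 : ℝ)).ofReal_comp
  have hp : HasDerivAt (fun t : ℝ => p.eval (t : ℂ)) (p.derivative.eval ((0 : ℝ) : ℂ)) 0 :=
    (p.hasDerivAt _).comp_ofReal
  have h2 := (((hid.const_mul (M⁻¹ * H).trace).const_add 1).fun_add
    (hp.fun_mul (hid.fun_pow 2))).const_mul M.det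
  refine h2.congr_deriv ?_
  have hdet : M.det ≠ 0 := hM.ne_zero
  rw [Matrix.inv_def, Ring.inverse_eq_inv', Matrix.smul_mul, Matrix.trace_smul]
  simp [hdet]

end Derivatives

/-! ### The divergence theorem on the cone -/

/-- A function of `d > 0` that vanishes for `d ≤ δ` and tends to `1` as `δ` tends to `0`. Its square
is continuously differentiable, and serves to cut off a neighbourhood of the boundary of the cone,
with `d` the determinant. Outside `d ≤ δ` it equals `y = 1 - δ / d`, so that the derivative of the
square is `2 y (1 - y) / d`. -/
noncomputable def cutoff (δ d : ℝ) : ℝ := max (d - δ) 0 / d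

theorem cutoff_of_le {δ d : ℝ} (h : d ≤ δ) : cutoff δ d = 0 := by
  rw [cutoff, max_eq_right (by linarith), zero_div]

theorem cutoff_nonneg {δ d : ℝ} (hd : 0 < d) : 0 ≤ cutoff δ d :=
  div_nonneg (le_max_right _ _) hd.le

theorem cutoff_le_one {δ d : ℝ} (hδ : 0 < δ) (hd : 0 < d) : cutoff δ d ≤ 1 := by
  rw [cutoff, div_le_one hd]
  exact max_le (by linarith) hd.le

theorem measurable_cutoff (δ : ℝ) : Measurable (cutoff δ) := by
  unfold cutoff
  fun_prop

theorem hasDerivAt_max_zero_sq (x : ℝ) :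
    HasDerivAt (fun x : ℝ => max x 0 ^ 2) (2 * max x 0) x := by
  rcases lt_trichotomy x 0 with h | rfl | h
  · rw [max_eq_right h.le, mul_zero]
    refine (hasDerivAt_const x (0 : ℝ)).congr_of_eventuallyEq ?_
    filter_upwards [gt_mem_nhds h] with y hy
    rw [max_eq_right hy.le]
    norm_num
  · rw [max_self, mul_zero, hasDerivAt_iff_isLittleO_nhds_zero]
    have h1 : (fun h : ℝ => max h 0 ^ 2) =O[𝓝 0] fun h : ℝ => h ^ 2 := by
      refine Asymptotics.IsBigO.of_bound 1 (Eventually.of_forall fun h => ?_)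
      rw [one_mul, norm_pow, norm_pow]
      refine pow_le_pow_left₀ (norm_nonneg _) ?_ 2
      rw [Real.norm_eq_abs, Real.norm_eq_abs, abs_of_nonneg (le_max_right h 0)]
      exact max_le (le_abs_self h) (abs_nonneg h)
    have h2 : (fun h : ℝ => h ^ 2) =o[𝓝 0] fun h : ℝ => h := by
      simpa using Asymptotics.isLittleO_pow_pow (𝕜 := ℝ) (m := 1) (n := 2) (by norm_num)
    simpa using h1.trans_isLittleO h2
  · rw [max_eq_left h.le]
    have h3 : HasDerivAt (fun x : ℝ => x ^ 2) (2 * x) x := by simpa using hasDerivAt_pow 2 x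
    refine h3.congr_of_eventuallyEq ?_
    filter_upwards [lt_mem_nhds h] with y hy
    rw [max_eq_left hy.le]

theorem hasDerivAt_cutoff_sq_mul_cpow (α : ℂ) (δ : ℝ) {d : ℝ} (hd : 0 < d) :
    HasDerivAt (fun d : ℝ => (cutoff δ d : ℂ) ^ 2 * (d : ℂ) ^ α)
      ((2 * cutoff δ d * (1 - cutoff δ d) + α * (cutoff δ d : ℂ) ^ 2) / d * (d : ℂ) ^ α) d := by
  have h1 : HasDerivAt (fun d : ℝ => ((max (d - δ) 0 ^ 2 : ℝ) : ℂ))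
      ((2 * max (d - δ) 0 : ℝ) : ℂ) d :=
    (HasDerivAt.comp_sub_const d δ (hasDerivAt_max_zero_sq (d - δ))).ofReal_comp
  have h2 : HasDerivAt (fun d : ℝ => (d : ℂ) ^ (α - 2)) ((α - 2) * (d : ℂ) ^ (α - 2 - 1)) d := by
    have hd0 : (d : ℂ) ∈ Complex.slitPlane := Or.inl (by simpa using hd)
    simpa using ((hasDerivAt_id (d : ℂ)).cpow_const hd0 (c := α - 2)).comp_ofReal
  have hne : (d : ℂ) ≠ 0 := by exact_mod_cast hd.ne'
  have e2 : (d : ℂ) ^ (α - 2) = (d : ℂ) ^ α / (d : ℂ) ^ 2 := by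
    rw [Complex.cpow_sub _ _ hne, ← Complex.cpow_natCast]
    norm_num
  have e3 : (d : ℂ) ^ (α - 2 - 1) = (d : ℂ) ^ α / (d : ℂ) ^ 2 / d := by
    rw [Complex.cpow_sub _ _ hne, e2, Complex.cpow_one]
  refine ((h1.fun_mul h2).congr_deriv ?_).congr_of_eventuallyEq ?_
  · rw [e2, e3, cutoff]
    push_cast
    field_simp
    ring
  · filter_upwards [lt_mem_nhds hd] with y hy
    have hne : (y : ℂ) ≠ 0 := by exact_mod_cast hy.ne'
    have e2 : (y : ℂ) ^ (α - 2) = (y : ℂ) ^ α / (y : ℂ) ^ 2 := by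
      rw [Complex.cpow_sub _ _ hne, ← Complex.cpow_natCast]
      norm_num
    rw [e2, cutoff]
    push_cast
    field_simp

section Stokes

variable {n : ℕ}

theorem hermOf_add_smul (x e : HermCoord n) (t : ℝ) :
    hermOf (x + t • e) = hermOf x + (t : ℂ) • hermOf e := by
  ext i j
  rcases lt_trichotomy i j with h | h | h
  · simp [hermOf, h]
  · subst h; simp [hermOf]
  · simp [hermOf, h, h.not_gt]

theorem det_hermOf_eq_re (x : HermCoord n) : (hermOf x).det = ((hermOf x).det.re : ℂ) := by
  have h : (starRingEnd ℂ) (hermOf x).det = (hermOf x).det := by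
    have := Matrix.det_conjTranspose (hermOf x)
    rw [(hermOf_isHermitian x).eq] at this
    exact this.symm
  exact (Complex.conj_eq_iff_re.mp h).symm

open scoped ComplexOrder in
theorem isClosed_setOf_posSemidef : IsClosed {x : HermCoord n | (hermOf x).PosSemidef} := by
  have : {x : HermCoord n | (hermOf x).PosSemidef} =
      ⋂ v : Fin n → ℂ, {x | 0 ≤ dotProduct (star v) ((hermOf x).mulVec v)} := by
    ext x
    simp only [Set.mem_ofPred_eq, Set.mem_iInter, Matrix.posSemidef_iff_dotProduct_mulVec,
      hermOf_isHermitian x, true_and]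
  rw [this]
  refine isClosed_iInter fun v => isClosed_le continuous_const ?_
  exact Continuous.dotProduct continuous_const (continuous_hermOf.matrix_mulVec continuous_const)

open scoped ComplexOrder in
/-- Near a matrix outside the open cone, elements of the cone have small determinant. -/
theorem eventually_det_le_of_notMem {x : HermCoord n} (hx : x ∉ posCone n) {δ : ℝ} (hδ : 0 < δ) :
    ∀ᶠ y in 𝓝 x, y ∈ posCone n → (hermOf y).det.re ≤ δ := by
  by_cases hps : (hermOf x).PosSemidef
  · have h0 : (hermOf x).det = 0 := by
      by_contra h
      exact hx (hps.posDef_iff_det_ne_zero.mpr h)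
    have hcont : Continuous fun y : HermCoord n => (hermOf y).det.re :=
      Complex.continuous_re.comp continuous_hermOf.matrix_det
    have := hcont.tendsto x
    rw [h0, Complex.zero_re] at this
    filter_upwards [this.eventually (gt_mem_nhds hδ)] with y hy _
    exact hy.le
  · have := isClosed_setOf_posSemidef.isOpen_compl.mem_nhds
      (show x ∈ {x : HermCoord n | (hermOf x).PosSemidef}ᶜ from hps)
    filter_upwards [this] with y hy hy'
    exact absurd (Matrix.PosDef.posSemidef hy') hy

/-- The derivative of `χ² det^α e^{-c tr} Q` at `M` in the direction `H`, where `χ` is the cutoff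
function of the determinant. It is complex linear in `H`. -/
noncomputable def cutoffDeriv (α : ℂ) (c δ : ℝ) (Q : Matrix (Fin n) (Fin n) ℂ → ℂ)
    (DQ : Matrix (Fin n) (Fin n) ℂ → Matrix (Fin n) (Fin n) ℂ →ₗ[ℂ] ℂ)
    (M H : Matrix (Fin n) (Fin n) ℂ) : ℂ :=
  laguerreWeight α c M *
    ((2 * cutoff δ M.det.re * (1 - cutoff δ M.det.re) + α * (cutoff δ M.det.re : ℂ) ^ 2) /
        (M.det.re : ℂ) * ((M.adjugate * H).trace * Q M)) +
  laguerreWeight α c M *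
    ((cutoff δ M.det.re : ℂ) ^ 2 * (DQ M H + -c * H.trace * Q M))

theorem measurable_det_re : Measurable fun x : HermCoord n => (hermOf x).det.re :=
  (Complex.continuous_re.comp continuous_hermOf.matrix_det).measurable

theorem norm_cutoff_sq_le {δ d : ℝ} (hδ : 0 < δ) (hd : 0 < d) : ‖(cutoff δ d : ℂ) ^ 2‖ ≤ 1 := by
  rw [norm_pow, Complex.norm_of_nonneg (cutoff_nonneg hd)]
  exact pow_le_one₀ (cutoff_nonneg hd) (cutoff_le_one hδ hd)

theorem norm_two_cutoff_mul_le {δ d : ℝ} (hδ : 0 < δ) (hd : 0 < d) :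
    ‖(2 * cutoff δ d * (1 - cutoff δ d) : ℂ)‖ ≤ 2 := by
  have h0 := cutoff_nonneg (δ := δ) hd
  have h1 := cutoff_le_one hδ hd
  rw [← Complex.ofReal_one, ← Complex.ofReal_sub, norm_mul, norm_mul,
    Complex.norm_of_nonneg h0, Complex.norm_of_nonneg (by linarith)]
  simp only [Complex.norm_ofNat]
  nlinarith

theorem norm_cutoff_coeff_le (α : ℂ) {δ d : ℝ} (hδ : 0 < δ) (hd : 0 < d) :
    ‖(2 * cutoff δ d * (1 - cutoff δ d) + α * (cutoff δ d : ℂ) ^ 2) / (d : ℂ)‖ ≤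
      (2 + ‖α‖) / δ := by
  rcases le_or_gt d δ with h | h
  · rw [cutoff_of_le h]
    simp
    positivity
  · rw [norm_div, Complex.norm_of_nonneg hd.le]
    refine div_le_div₀ (by positivity) ?_ hδ h.le
    refine (norm_add_le _ _).trans (add_le_add (norm_two_cutoff_mul_le hδ hd) ?_)
    rw [norm_mul]
    exact mul_le_of_le_one_right (norm_nonneg _) (norm_cutoff_sq_le hδ hd)

variable {Q : Matrix (Fin n) (Fin n) ℂ → ℂ}
  {DQ : Matrix (Fin n) (Fin n) ℂ → Matrix (Fin n) (Fin n) ℂ →ₗ[ℂ] ℂ}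

theorem integrableOn_cutoffDeriv (hQ : HasTameDeriv Q DQ) {α : ℂ} (hα : -1 < α.re) {c δ : ℝ}
    (hc : 0 < c) (hδ : 0 < δ) (H : Matrix (Fin n) (Fin n) ℂ) :
    IntegrableOn (fun x => cutoffDeriv α c δ Q DQ (hermOf x) H) (posCone n) := by
  have hm : Measurable fun x : HermCoord n => (cutoff δ (hermOf x).det.re : ℂ) :=
    Complex.measurable_ofReal.comp ((measurable_cutoff δ).comp measurable_det_re)
  have hm' : Measurable fun x : HermCoord n => ((hermOf x).det.re : ℂ) :=
    Complex.measurable_ofReal.comp measurable_det_re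
  have hadj : Tame fun M : Matrix (Fin n) (Fin n) ℂ => (M.adjugate * H).trace :=
    tame_trace (tame_mul_entry tame_adjugate_entry fun _ _ => tame_const _)
  refine Integrable.add ((hadj.mul hQ.tame).integrableOn hα hc (u := fun x =>
    (2 * cutoff δ (hermOf x).det.re * (1 - cutoff δ (hermOf x).det.re) +
      α * (cutoff δ (hermOf x).det.re : ℂ) ^ 2) / ((hermOf x).det.re : ℂ)) (by fun_prop)
      fun x hx => norm_cutoff_coeff_le α hδ (det_pos_of_mem hx).1)
    (((hQ.tame_deriv H).add ((tame_const (-c * H.trace)).mul hQ.tame)).integrableOn hα hc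
      (u := fun x => (cutoff δ (hermOf x).det.re : ℂ) ^ 2) (by fun_prop)
      fun x hx => norm_cutoff_sq_le hδ (det_pos_of_mem hx).1)

/-- Extended by zero, the cut-off function is differentiable along lines on the whole space: a
boundary point of the cone has a neighbourhood on which it vanishes. -/
theorem hasLineDerivAt_cutoff (hQ : HasTameDeriv Q DQ) (α : ℂ) (c : ℝ) {δ : ℝ} (hδ : 0 < δ)
    (e x : HermCoord n) :
    HasLineDerivAt ℝ ((posCone n).indicator fun x => laguerreWeight α c (hermOf x) *
        ((cutoff δ (hermOf x).det.re : ℂ) ^ 2 * Q (hermOf x)))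
      ((posCone n).indicator (fun x => cutoffDeriv α c δ Q DQ (hermOf x) (hermOf e)) x) x e := by
  have hline : Tendsto (fun t : ℝ => x + t • e) (𝓝 0) (𝓝 x) := by
    have : Continuous fun t : ℝ => x + t • e := by fun_prop
    simpa using this.tendsto 0
  unfold HasLineDerivAt
  by_cases hx : x ∈ posCone n
  · rw [Set.indicator_of_mem hx]
    obtain ⟨hd, hdet⟩ := det_pos_of_mem hx
    set M := hermOf x with hM
    set H := hermOf e with hH
    have hD : HasDerivAt (fun t : ℝ => (M + (t : ℂ) • H).det) (M.adjugate * H).trace 0 :=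
      hasDerivAt_det (by
        rw [hdet]
        exact (by exact_mod_cast hd.ne' : ((M.det.re : ℝ) : ℂ) ≠ 0).isUnit) H
    have hDre : HasDerivAt (fun t : ℝ => (M + (t : ℂ) • H).det.re) (M.adjugate * H).trace.re 0 :=
      Complex.reCLM.hasFDerivAt.comp_hasDerivAt 0 hD
    -- determinants of Hermitian matrices are real, hence so is the derivative
    have hreal : ((M.adjugate * H).trace.re : ℂ) = (M.adjugate * H).trace := by
      refine hDre.ofReal_comp.unique (hD.congr_of_eventuallyEq (Eventually.of_forall fun t => ?_))
      simp only [hM, hH, ← hermOf_add_smul]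
      exact (det_hermOf_eq_re _).symm
    have hM0 : M + ((0 : ℝ) : ℂ) • H = M := by simp
    have hcut := hasDerivAt_cutoff_sq_mul_cpow α δ hd
    rw [← hM0] at hcut
    have h1 := hcut.scomp (0 : ℝ) hDre
    simp only [hM0] at h1
    have htr : HasDerivAt (fun t : ℝ => (M + (t : ℂ) • H).trace) H.trace 0 := by
      simpa using hasDerivAt_trace_pow 1 M H
    have h2 : HasDerivAt (fun t : ℝ => Complex.exp (-(c * (M + (t : ℂ) • H).trace))) _ 0 :=
      (htr.const_mul (c : ℂ)).fun_neg.cexp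
    have h3 := (h1.fun_mul h2).fun_mul (hQ.hasDerivAt M H)
    refine (h3.congr_deriv ?_).congr_of_eventuallyEq ?_
    · rw [hM0, cutoffDeriv, laguerreWeight]
      simp only [Function.comp, hM0, Complex.real_smul, hreal]
      rw [← hdet]
      ring
    · filter_upwards [hline.eventually ((isOpen_posCone n).mem_nhds hx)] with t ht
      rw [Set.indicator_of_mem (show x + t • e ∈ posCone n from ht), laguerreWeight]
      simp only [Function.comp, hM, hH, ← hermOf_add_smul, ← det_hermOf_eq_re]
      ring
  · rw [Set.indicator_of_notMem hx]
    refine (hasDerivAt_const (0 : ℝ) (0 : ℂ)).congr_of_eventuallyEq ?_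
    filter_upwards [hline.eventually (eventually_det_le_of_notMem hx hδ)] with t ht
    by_cases hmem : x + t • e ∈ posCone n
    · rw [Set.indicator_of_mem hmem, cutoff_of_le (ht hmem)]
      simp
    · rw [Set.indicator_of_notMem hmem]

/-- The integral of a derivative in a Hermitian direction vanishes, by integration by parts against
the constant function `1`. -/
theorem integral_cutoffDeriv_hermOf (hQ : HasTameDeriv Q DQ) {α : ℂ} (hα : -1 < α.re) {c δ : ℝ}
    (hc : 0 < c) (hδ : 0 < δ) (e : HermCoord n) :
    ∫ x in posCone n, cutoffDeriv α c δ Q DQ (hermOf x) (hermOf e) = 0 := by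
  have hm : Measurable fun x : HermCoord n => (cutoff δ (hermOf x).det.re : ℂ) :=
    Complex.measurable_ofReal.comp ((measurable_cutoff δ).comp measurable_det_re)
  have hF : IntegrableOn (fun x => laguerreWeight α c (hermOf x) *
        ((cutoff δ (hermOf x).det.re : ℂ) ^ 2 * Q (hermOf x))) (posCone n) :=
    hQ.tame.integrableOn hα hc (u := fun x => (cutoff δ (hermOf x).det.re : ℂ) ^ 2) (by fun_prop)
      fun x hx => norm_cutoff_sq_le hδ (det_pos_of_mem hx).1
  have h1 : Integrable ((posCone n).indicator fun x =>
      cutoffDeriv α c δ Q DQ (hermOf x) (hermOf e)) :=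
    (integrable_indicator_iff (measurableSet_posCone n)).mpr
      (integrableOn_cutoffDeriv hQ hα hc hδ (hermOf e))
  have h2 := (integrable_indicator_iff (measurableSet_posCone n)).mpr hF
  have h := integral_bilinear_hasLineDerivAt_right_eq_neg_left_of_integrable
    (μ := (volume : Measure (HermCoord n))) (f := fun _ => (1 : ℂ)) (f' := fun _ => (0 : ℂ))
    (g := (posCone n).indicator fun x => laguerreWeight α c (hermOf x) *
        ((cutoff δ (hermOf x).det.re : ℂ) ^ 2 * Q (hermOf x)))
    (g' := (posCone n).indicator fun x => cutoffDeriv α c δ Q DQ (hermOf x) (hermOf e))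
    (v := e) (B := ContinuousLinearMap.mul ℝ ℂ) (by simp)
    (by simpa using h1) (by simpa using h2)
    (fun x _ => by
      unfold HasLineDerivAt
      exact hasDerivAt_const _ _)
    (fun x _ => hasLineDerivAt_cutoff hQ α c hδ e x)
  simpa [integral_indicator (measurableSet_posCone n)] using h

theorem exists_hermOf_eq {M : Matrix (Fin n) (Fin n) ℂ} (hM : M.IsHermitian) :
    ∃ x : HermCoord n, hermOf x = M := by
  refine ⟨(fun i => (M i i).re, fun q => M q.1.1 q.1.2), ?_⟩
  ext i j
  rcases lt_trichotomy i j with h | h | h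
  · simp [hermOf, h]
  · subst h
    simpa [hermOf] using Complex.conj_eq_iff_re.mp (hM.apply i i)
  · simpa [hermOf, h, h.not_gt] using hM.apply i j

/-- A complex matrix is the sum of a Hermitian and an anti-Hermitian one. -/
theorem exists_eq_hermOf_add (H : Matrix (Fin n) (Fin n) ℂ) :
    ∃ e f : HermCoord n, H = hermOf e + Complex.I • hermOf f := by
  obtain ⟨e, he⟩ := exists_hermOf_eq (M := (1 / 2 : ℂ) • (H + H.conjTranspose)) (by
    ext i j
    simp
    ring)
  obtain ⟨f, hf⟩ := exists_hermOf_eq (M := (-Complex.I / 2) • (H - H.conjTranspose)) (by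
    ext i j
    simp
    ring)
  refine ⟨e, f, ?_⟩
  rw [he, hf]
  ext i j
  simp only [Matrix.add_apply, Matrix.smul_apply, Matrix.sub_apply, smul_eq_mul]
  linear_combination (1 / 2 : ℂ) * (H i j - H.conjTranspose i j) * Complex.I_sq

/-- The integral of the derivative vanishes in every direction `H`, Hermitian or not, because
`cutoffDeriv` is complex linear in `H`. This allows for the matrix units as directions. -/
theorem integral_cutoffDeriv (hQ : HasTameDeriv Q DQ) {α : ℂ} (hα : -1 < α.re) {c δ : ℝ}
    (hc : 0 < c) (hδ : 0 < δ) (H : Matrix (Fin n) (Fin n) ℂ) :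
    ∫ x in posCone n, cutoffDeriv α c δ Q DQ (hermOf x) H = 0 := by
  obtain ⟨e, f, rfl⟩ := exists_eq_hermOf_add H
  have h (x : HermCoord n) :
      cutoffDeriv α c δ Q DQ (hermOf x) (hermOf e + Complex.I • hermOf f) =
      cutoffDeriv α c δ Q DQ (hermOf x) (hermOf e) +
        Complex.I * cutoffDeriv α c δ Q DQ (hermOf x) (hermOf f) := by
    simp only [cutoffDeriv, mul_add, Matrix.mul_smul, Matrix.trace_add, Matrix.trace_smul, map_add,
      map_smul, smul_eq_mul]
    ring
  simp only [h]
  rw [integral_add (integrableOn_cutoffDeriv hQ hα hc hδ _)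
    ((integrableOn_cutoffDeriv hQ hα hc hδ _).const_mul _), integral_const_mul,
    integral_cutoffDeriv_hermOf hQ hα hc hδ, integral_cutoffDeriv_hermOf hQ hα hc hδ]
  simp

end Stokes

/-! ### Loop equations -/

section Loop

variable {n : ℕ}

/-- The coefficient `∏_j t_j ^ μ_j / μ_j!` of `exp (∑_j p_j t_j)`, with
`t_j = tr (M ^ j) / (j ε)`. -/
noncomputable def timePoly (ε : ℝ) (μ : ℕ+ →₀ ℕ) (M : Matrix (Fin n) (Fin n) ℂ) : ℂ :=
  μ.prod fun j m => ((M ^ (j : ℕ)).trace / ((j : ℂ) * (ε : ℂ))) ^ m / (m ! : ℂ)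

/-- The derivative of `timePoly ε μ`. -/
noncomputable def timePolyDeriv (ε : ℝ) (μ : ℕ+ →₀ ℕ) (M : Matrix (Fin n) (Fin n) ℂ) :
    Matrix (Fin n) (Fin n) ℂ →ₗ[ℂ] ℂ :=
  ∑ j ∈ μ.support, (timePoly ε (μ - Finsupp.single j 1) M / ε) •
    (Matrix.traceLinearMap (Fin n) ℂ ℂ ∘ₗ LinearMap.mulLeft ℂ (M ^ ((j : ℕ) - 1)))

theorem timePolyDeriv_apply (ε : ℝ) (μ : ℕ+ →₀ ℕ) (M H : Matrix (Fin n) (Fin n) ℂ) :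
    timePolyDeriv ε μ M H = ∑ j ∈ μ.support,
      timePoly ε (μ - Finsupp.single j 1) M / ε * (M ^ ((j : ℕ) - 1) * H).trace := by
  simp [timePolyDeriv]

theorem tame_timePoly (ε : ℝ) (μ : ℕ+ →₀ ℕ) :
    Tame (timePoly ε μ : Matrix (Fin n) (Fin n) ℂ → ℂ) := by
  unfold timePoly
  simp only [Finsupp.prod, div_eq_mul_inv]
  exact Tame.prod _ fun j _ =>
    (((tame_trace (tame_pow_entry _)).mul (tame_const _)).pow _).mul (tame_const _)

theorem timePoly_eq_prod (ε : ℝ) {μ : ℕ+ →₀ ℕ} {S : Finset ℕ+} (hS : μ.support ⊆ S)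
    (M : Matrix (Fin n) (Fin n) ℂ) :
    timePoly ε μ M = ∏ j ∈ S, ((M ^ (j : ℕ)).trace / ((j : ℂ) * (ε : ℂ))) ^ μ j / ((μ j)! : ℂ) :=
  Finsupp.prod_of_support_subset μ hS _ fun _ _ => by simp

theorem timePoly_zero (ε : ℝ) (M : Matrix (Fin n) (Fin n) ℂ) : timePoly ε 0 M = 1 := by
  simp [timePoly]

/-- The generating series of `timePoly ε μ` is an eigenvector of `∂/∂p_j` for `t_j`. -/
theorem timePoly_add_single (ε : ℝ) (μ : ℕ+ →₀ ℕ) (i : ℕ+) (M : Matrix (Fin n) (Fin n) ℂ) :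
    timePoly ε (μ + Finsupp.single i 1) M * (μ i + 1) =
      (M ^ (i : ℕ)).trace / ((i : ℂ) * (ε : ℂ)) * timePoly ε μ M := by
  have hS : μ.support ⊆ insert i μ.support := Finset.subset_insert _ _
  have hS' : (μ + Finsupp.single i 1).support ⊆ insert i μ.support := by
    refine Finsupp.support_add.trans (Finset.union_subset hS ?_)
    exact Finsupp.support_single_subset.trans (by simp)
  have hi : i ∈ insert i μ.support := Finset.mem_insert_self _ _
  rw [timePoly_eq_prod ε hS, timePoly_eq_prod ε hS', ← Finset.mul_prod_erase _ _ hi,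
    ← Finset.mul_prod_erase _ _ hi]
  have hprod : ∏ j ∈ (insert i μ.support).erase i,
      ((M ^ (j : ℕ)).trace / ((j : ℂ) * (ε : ℂ))) ^ (μ + Finsupp.single i 1 : ℕ+ →₀ ℕ) j /
        (((μ + Finsupp.single i 1 : ℕ+ →₀ ℕ) j)! : ℂ) =
      ∏ j ∈ (insert i μ.support).erase i,
      ((M ^ (j : ℕ)).trace / ((j : ℂ) * (ε : ℂ))) ^ μ j / ((μ j)! : ℂ) := by
    refine Finset.prod_congr rfl fun j hj => ?_
    have : i ≠ j := (Finset.ne_of_mem_erase hj).symm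
    simp [this]
  have hf : ((μ i)! : ℂ) ≠ 0 := by exact_mod_cast Nat.factorial_ne_zero _
  have hf' : (μ i : ℂ) + 1 ≠ 0 := Nat.cast_add_one_ne_zero _
  rw [hprod]
  simp only [Finsupp.add_apply, Finsupp.single_eq_same, pow_succ, Nat.factorial_succ, Nat.cast_mul,
    Nat.cast_add, Nat.cast_one]
  generalize (M ^ (i : ℕ)).trace / ((i : ℂ) * (ε : ℂ)) = t
  generalize (∏ j ∈ (insert i μ.support).erase i,
    ((M ^ (j : ℕ)).trace / ((j : ℂ) * (ε : ℂ))) ^ μ j / ((μ j)! : ℂ)) = p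
  field_simp

theorem hasTameDeriv_timePoly (ε : ℝ) (μ : ℕ+ →₀ ℕ) :
    HasTameDeriv (timePoly ε μ : Matrix (Fin n) (Fin n) ℂ → ℂ) (timePolyDeriv ε μ) where
  tame := tame_timePoly ε μ
  tame_deriv H := by
    simp only [timePolyDeriv_apply, div_eq_mul_inv]
    exact Tame.sum _ fun j _ => ((tame_timePoly ε _).mul (tame_const _)).mul
      (tame_trace (tame_mul_entry (tame_pow_entry _) fun _ _ => tame_const _))
  hasDerivAt M H := by
    have hM0 : M + ((0 : ℝ) : ℂ) • H = M := by simp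
    have hj (j : ℕ+) (_ : j ∈ μ.support) : HasDerivAt
        (fun t : ℝ => (((M + (t : ℂ) • H) ^ (j : ℕ)).trace / ((j : ℂ) * (ε : ℂ))) ^ μ j /
          ((μ j)! : ℂ)) _ 0 :=
      (((hasDerivAt_trace_pow (j : ℕ) M H).div_const ((j : ℂ) * (ε : ℂ))).fun_pow (μ j)).div_const
        ((μ j)! : ℂ)
    refine (HasDerivAt.fun_finsetProd hj).congr_deriv ?_
    rw [timePolyDeriv_apply]
    refine Finset.sum_congr rfl fun j hj => ?_
    have hμ : μ j ≠ 0 := Finsupp.mem_support_iff.mp hj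
    have hsub : (μ - Finsupp.single j 1).support ⊆ μ.support := Finsupp.support_tsub
    rw [timePoly_eq_prod ε hsub, ← Finset.mul_prod_erase _ _ hj]
    have hprod : ∏ i ∈ μ.support.erase j,
        ((M ^ (i : ℕ)).trace / ((i : ℂ) * (ε : ℂ))) ^ (μ - Finsupp.single j 1 : ℕ+ →₀ ℕ) i /
          (((μ - Finsupp.single j 1 : ℕ+ →₀ ℕ) i)! : ℂ) =
        ∏ i ∈ μ.support.erase j,
        ((M ^ (i : ℕ)).trace / ((i : ℂ) * (ε : ℂ))) ^ μ i / ((μ i)! : ℂ) := by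
      refine Finset.prod_congr rfl fun i hi => ?_
      have : j ≠ i := (Finset.ne_of_mem_erase hi).symm
      simp [this]
    rw [hprod]
    simp only [hM0, Finsupp.tsub_apply, Finsupp.single_eq_same, smul_eq_mul]
    obtain ⟨m, hm⟩ := Nat.exists_eq_succ_of_ne_zero hμ
    have hj0 : (j : ℂ) ≠ 0 := by exact_mod_cast j.ne_zero
    have hf : ((m)! : ℂ) ≠ 0 := by exact_mod_cast Nat.factorial_ne_zero _
    have hf' : (m : ℂ) + 1 ≠ 0 := Nat.cast_add_one_ne_zero _
    rw [hm]
    simp only [Nat.succ_eq_add_one, Nat.add_sub_cancel, Nat.factorial_succ, Nat.cast_mul,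
      Nat.cast_add, Nat.cast_one]
    generalize (∏ i ∈ μ.support.erase j,
        ((M ^ (i : ℕ)).trace / ((i : ℂ) * (ε : ℂ))) ^ μ i / ((μ i)! : ℂ)) = p
    generalize ((M ^ (j : ℕ)).trace / ((j : ℂ) * (ε : ℂ))) ^ m = q
    rw [mul_div_mul_left _ _ hj0]
    field_simp

theorem sum_entry_mul_apply_single (L : Matrix (Fin n) (Fin n) ℂ →ₗ[ℂ] ℂ)
    (B : Matrix (Fin n) (Fin n) ℂ) :
    ∑ i, ∑ j, B i j * L (Matrix.single i j 1) = L B := by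
  conv_rhs => rw [Matrix.matrix_eq_sum_single B]
  simp only [map_sum]
  refine Finset.sum_congr rfl fun i _ => Finset.sum_congr rfl fun j _ => ?_
  rw [← smul_eq_mul, ← map_smul, Matrix.smul_single, smul_eq_mul, mul_one]

/-- The divergence of the vector field `M ^ (k + 1)`. -/
theorem sum_powDeriv_single (k : ℕ) (M : Matrix (Fin n) (Fin n) ℂ) :
    ∑ i, ∑ j, powDeriv (k + 1) M (Matrix.single i j 1) i j =
      ∑ a ∈ Finset.range (k + 1), (M ^ a).trace * (M ^ (k - a)).trace := by
  simp only [powDeriv_apply, Matrix.sum_apply, Nat.add_sub_cancel]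
  rw [Finset.sum_congr rfl fun i _ => Finset.sum_comm, Finset.sum_comm]
  refine Finset.sum_congr rfl fun a _ => ?_
  rw [Matrix.trace, Matrix.trace, Finset.sum_mul_sum]
  refine Finset.sum_congr rfl fun i _ => Finset.sum_congr rfl fun j _ => ?_
  rw [← mul_assoc, Matrix.mul_apply, Finset.sum_eq_single j]
  · simp [Matrix.mul_apply, Matrix.single_apply]
  · intro l _ hl
    simp [Matrix.mul_apply, hl.symm]
  · simp

/-- The divergence, divided by the weight, of the vector field `M ^ (k + 1)` multiplied by
`det^α e^{-c tr}` and a coefficient of the generating function. -/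
noncomputable def loopIntegrand (α : ℂ) (c ε : ℝ) (k : ℕ) (μ : ℕ+ →₀ ℕ)
    (M : Matrix (Fin n) (Fin n) ℂ) : ℂ :=
  α * ((M ^ k).trace * timePoly ε μ M)
    + (timePoly ε μ M * ∑ a ∈ Finset.range (k + 1), (M ^ a).trace * (M ^ (k - a)).trace
    + timePolyDeriv ε μ M (M ^ (k + 1)) + -c * ((M ^ (k + 1)).trace * timePoly ε μ M))

theorem tame_timePolyDeriv_pow (ε : ℝ) (μ : ℕ+ →₀ ℕ) (k : ℕ) :
    Tame fun M : Matrix (Fin n) (Fin n) ℂ => timePolyDeriv ε μ M (M ^ k) := by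
  simp only [timePolyDeriv_apply, div_eq_mul_inv]
  exact Tame.sum _ fun j _ => ((tame_timePoly ε _).mul (tame_const _)).mul
    (tame_trace (tame_mul_entry (tame_pow_entry _) (tame_pow_entry _)))

theorem tame_loopIntegrand (α : ℂ) (c ε : ℝ) (k : ℕ) (μ : ℕ+ →₀ ℕ) :
    Tame (loopIntegrand α c ε k μ : Matrix (Fin n) (Fin n) ℂ → ℂ) := by
  have htr (m : ℕ) : Tame fun M : Matrix (Fin n) (Fin n) ℂ => (M ^ m).trace :=
    tame_trace (tame_pow_entry m)
  have hT := tame_timePoly (n := n) ε μ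
  exact ((tame_const α).mul ((htr k).mul hT)).add (((hT.mul (Tame.sum _ fun a _ =>
    (htr a).mul (htr (k - a)))).add (tame_timePolyDeriv_pow ε μ (k + 1))).add
    ((tame_const (-c)).mul ((htr (k + 1)).mul hT)))

/-- The divergence of the vector field `M ^ (k + 1)` times the cut-off weight. The second summand
comes from the derivative of the cutoff, and tends to `0` with `δ`: the pole `1 / det M` is
cancelled by `adjugate M * M = det M`. -/
theorem sum_cutoffDeriv (α : ℂ) (c ε δ : ℝ) (k : ℕ) (μ : ℕ+ →₀ ℕ) {x : HermCoord n}
    (hx : x ∈ posCone n) :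
    ∑ i, ∑ j, cutoffDeriv α c δ (fun M => timePoly ε μ M * (M ^ (k + 1)) i j)
      (fun M => (M ^ (k + 1)) i j • timePolyDeriv ε μ M +
        timePoly ε μ M • (Matrix.entryLinearMap ℂ ℂ i j ∘ₗ powDeriv (k + 1) M))
      (hermOf x) (Matrix.single i j 1) =
    laguerreWeight α c (hermOf x) * ((cutoff δ (hermOf x).det.re : ℂ) ^ 2 *
      loopIntegrand α c ε k μ (hermOf x)) +
    laguerreWeight α c (hermOf x) *
      (2 * cutoff δ (hermOf x).det.re * (1 - cutoff δ (hermOf x).det.re) *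
        (((hermOf x) ^ k).trace * timePoly ε μ (hermOf x))) := by
  obtain ⟨hd, hdet⟩ := det_pos_of_mem hx
  have hne : ((hermOf x).det.re : ℂ) ≠ 0 := by exact_mod_cast hd.ne'
  set M := hermOf x
  generalize hy : (cutoff δ M.det.re : ℂ) = y
  have s1 := sum_entry_mul_apply_single
    (Matrix.traceLinearMap (Fin n) ℂ ℂ ∘ₗ LinearMap.mulLeft ℂ M.adjugate) (M ^ (k + 1))
  have s2 := sum_entry_mul_apply_single (timePolyDeriv ε μ M) (M ^ (k + 1))
  have s3 := sum_entry_mul_apply_single (Matrix.traceLinearMap (Fin n) ℂ ℂ) (M ^ (k + 1))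
  simp only [LinearMap.comp_apply, LinearMap.mulLeft_apply, Matrix.traceLinearMap_apply] at s1 s3
  have hadj : (M.adjugate * M ^ (k + 1)).trace = M.det.re * (M ^ k).trace := by
    rw [pow_succ', ← mul_assoc, Matrix.adjugate_mul, Matrix.smul_mul, one_mul, Matrix.trace_smul,
      smul_eq_mul, ← hdet]
  rw [hadj] at s1
  have hsum : ∑ i, ∑ j, cutoffDeriv α c δ (fun M => timePoly ε μ M * (M ^ (k + 1)) i j)
      (fun M => (M ^ (k + 1)) i j • timePolyDeriv ε μ M +
        timePoly ε μ M • (Matrix.entryLinearMap ℂ ℂ i j ∘ₗ powDeriv (k + 1) M))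
      M (Matrix.single i j 1) =
      laguerreWeight α c M * ((2 * y * (1 - y) + α * y ^ 2) / (M.det.re : ℂ) * timePoly ε μ M) *
        (∑ i, ∑ j, (M ^ (k + 1)) i j * (M.adjugate * Matrix.single i j 1).trace) +
      laguerreWeight α c M * y ^ 2 *
        (∑ i, ∑ j, (M ^ (k + 1)) i j * timePolyDeriv ε μ M (Matrix.single i j 1)) +
      laguerreWeight α c M * y ^ 2 * timePoly ε μ M *
        (∑ i, ∑ j, powDeriv (k + 1) M (Matrix.single i j 1) i j) -
      laguerreWeight α c M * y ^ 2 * c * timePoly ε μ M *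
        (∑ i, ∑ j, (M ^ (k + 1)) i j * (Matrix.single i j (1 : ℂ)).trace) := by
    simp only [Finset.mul_sum, ← Finset.sum_add_distrib, ← Finset.sum_sub_distrib]
    refine Finset.sum_congr rfl fun i _ => Finset.sum_congr rfl fun j _ => ?_
    simp only [cutoffDeriv, hy, LinearMap.add_apply, LinearMap.smul_apply, LinearMap.comp_apply,
      Matrix.entryLinearMap_apply, smul_eq_mul]
    ring
  rw [hsum, s1, s2, s3, sum_powDeriv_single, loopIntegrand]
  field_simp
  ring

theorem tendsto_cutoff {d : ℝ} (hd : 0 < d) :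
    Tendsto (fun m : ℕ => (cutoff (1 / ((m : ℝ) + 1)) d : ℂ)) atTop (𝓝 1) := by
  have h1 : Tendsto (fun m : ℕ => cutoff (1 / ((m : ℝ) + 1)) d) atTop (𝓝 (max (d - 0) 0 / d)) :=
    ((tendsto_one_div_add_atTop_nhds_zero_nat.const_sub d).max tendsto_const_nhds).div_const d
  rw [sub_zero, max_eq_left hd.le, div_self hd.ne'] at h1
  exact_mod_cast (Complex.continuous_ofReal.tendsto 1).comp h1

/-- The loop equation: the integral of the divergence vanishes. -/
theorem integral_loopIntegrand {α : ℂ} (hα : -1 < α.re) {c : ℝ} (hc : 0 < c) (ε : ℝ) (k : ℕ)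
    (μ : ℕ+ →₀ ℕ) :
    ∫ x in posCone n, laguerreWeight α c (hermOf x) * loopIntegrand α c ε k μ (hermOf x) = 0 := by
  set S : Matrix (Fin n) (Fin n) ℂ → ℂ := fun M => (M ^ k).trace * timePoly ε μ M with hS
  set R : Matrix (Fin n) (Fin n) ℂ → ℂ := loopIntegrand α c ε k μ with hR
  have hSt : Tame S := (tame_trace (tame_pow_entry k)).mul (tame_timePoly ε μ)
  have hRt : Tame R := tame_loopIntegrand α c ε k μ
  have hpos (m : ℕ) : (0 : ℝ) < 1 / ((m : ℝ) + 1) := by positivity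
  set y : ℕ → HermCoord n → ℂ := fun m x => (cutoff (1 / ((m : ℝ) + 1)) (hermOf x).det.re : ℂ)
    with hy
  set F : ℕ → HermCoord n → ℂ := fun m x =>
    laguerreWeight α c (hermOf x) * (y m x ^ 2 * R (hermOf x)) +
      laguerreWeight α c (hermOf x) * (2 * y m x * (1 - y m x) * S (hermOf x)) with hF
  have hzero (m : ℕ) : ∫ x in posCone n, F m x = 0 := by
    have hD (i j : Fin n) :=
      (hasTameDeriv_timePoly (n := n) ε μ).mul (hasTameDeriv_pow_entry (k + 1) i j)
    rw [← setIntegral_congr_fun (measurableSet_posCone n)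
      fun x hx => sum_cutoffDeriv α c ε (1 / ((m : ℝ) + 1)) k μ hx]
    rw [integral_finsetSum _ fun i _ => integrable_finsetSum _ fun j _ =>
      integrableOn_cutoffDeriv (hD i j) hα hc (hpos m) _]
    refine Finset.sum_eq_zero fun i _ => ?_
    rw [integral_finsetSum _ fun j _ => integrableOn_cutoffDeriv (hD i j) hα hc (hpos m) _]
    exact Finset.sum_eq_zero fun j _ => integral_cutoffDeriv (hD i j) hα hc (hpos m) _
  have hmy (m : ℕ) : Measurable (y m) :=
    Complex.measurable_ofReal.comp ((measurable_cutoff _).comp measurable_det_re)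
  have hmw := measurable_laguerreWeight (n := n) α c
  have hmR := (hRt.1.comp continuous_hermOf).measurable
  have hmS := (hSt.1.comp continuous_hermOf).measurable
  have hlim := tendsto_integral_of_dominated_convergence (μ := volume.restrict (posCone n))
    (F := F) (f := fun x => laguerreWeight α c (hermOf x) * R (hermOf x))
    (fun x => ‖laguerreWeight α c (hermOf x) * R (hermOf x)‖ +
      2 * ‖laguerreWeight α c (hermOf x) * S (hermOf x)‖)
    (fun m => ((hmw.mul (((hmy m).pow_const 2).mul hmR)).add
      (hmw.mul ((((hmy m).const_mul 2).mul ((hmy m).const_sub 1)).mul hmS))).aestronglyMeasurable)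
    ((hRt.integrableOn_mul hα hc).norm.add ((hSt.integrableOn_mul hα hc).norm.const_mul 2))
    (fun m => by
      filter_upwards [ae_restrict_mem (measurableSet_posCone n)] with x hx
      have hd := (det_pos_of_mem hx).1
      refine (norm_add_le _ _).trans (add_le_add ?_ ?_)
      · rw [mul_left_comm, norm_mul]
        exact mul_le_of_le_one_left (norm_nonneg _) (norm_cutoff_sq_le (hpos m) hd)
      · rw [mul_left_comm, norm_mul]
        exact mul_le_mul_of_nonneg_right (norm_two_cutoff_mul_le (hpos m) hd) (norm_nonneg _))
    (by
      filter_upwards [ae_restrict_mem (measurableSet_posCone n)] with x hx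
      have h1 := tendsto_cutoff (det_pos_of_mem hx).1
      have h2 := (((h1.pow 2).mul_const (R (hermOf x))).const_mul
        (laguerreWeight α c (hermOf x))).add
        ((((h1.const_mul 2).mul (h1.const_sub 1)).mul_const (S (hermOf x))).const_mul
        (laguerreWeight α c (hermOf x)))
      simpa only [one_pow, one_mul, mul_one, sub_self, mul_zero, zero_mul, add_zero] using h2)
  simp only [hzero] at hlim
  exact tendsto_nhds_unique hlim tendsto_const_nhds

end Loop

/-! ### The partition function satisfies the Virasoro constraints -/

section Virasoro

variable {n : ℕ}

theorem taylorCoeff_eq (α : ℂ) (ε : ℝ) (μ : ℕ+ →₀ ℕ) (M : Matrix (Fin n) (Fin n) ℂ) :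
    taylorCoeff α ε μ M = laguerreWeight α (1 / ε) M * timePoly ε μ M := by
  have : -M.trace / (ε : ℂ) = -(((1 / ε : ℝ) : ℂ) * M.trace) := by
    push_cast
    ring
  rw [taylorCoeff, laguerreWeight, timePoly, this]

/-- The normalizing factor of the partition function. -/
noncomputable def partitionConst (n : ℕ) (α : ℂ) (ε : ℝ) : ℂ :=
  barnesG (α + 1) * (ε : ℂ) ^ (-(n : ℂ) ^ 2 - α * n) /
    ((Real.pi : ℂ) ^ (n * (n - 1) / 2) * barnesG (n + α + 1))

/-- The expectation of `Q` with respect to the normalized Laguerre weight. -/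
noncomputable def expect (α : ℂ) (ε : ℝ) (Q : Matrix (Fin n) (Fin n) ℂ → ℂ) : ℂ :=
  partitionConst n α ε * ∫ x in posCone n, laguerreWeight α (1 / ε) (hermOf x) * Q (hermOf x)

theorem coeff_partitionFunction (α : ℂ) (ε : ℝ) (μ : ℕ+ →₀ ℕ) :
    MvPowerSeries.coeff μ (partitionFunction n α ε) =
      expect α ε (timePoly ε μ : Matrix (Fin n) (Fin n) ℂ → ℂ) := by
  simp only [expect, ← taylorCoeff_eq]
  rfl

theorem expect_const_mul (α : ℂ) (ε : ℝ) (z : ℂ) (Q : Matrix (Fin n) (Fin n) ℂ → ℂ) :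
    expect α ε (fun M => z * Q M) = z * expect α ε Q := by
  simp only [expect, mul_left_comm _ z]
  rw [integral_const_mul]
  ring

/-- The Laguerre weight is normalized: the total mass is a product of values of `Γ`, hence a
quotient of Barnes functions. -/
theorem expect_one {α : ℂ} (hα : -1 < α.re) {ε : ℝ} (hε : 0 < ε) :
    expect α ε (fun _ : Matrix (Fin n) (Fin n) ℂ => 1) = 1 := by
  have hα1 : 0 < (α + 1).re := by simp; linarith
  have hG1 := barnesG_ne_zero hα1
  have hG2 : barnesG (α + 1 + n) ≠ 0 := by
    refine barnesG_ne_zero ?_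
    rw [Complex.add_re, Complex.natCast_re]
    positivity
  have hG := barnesG_add_natCast hα1 n
  have hε0 : (ε : ℂ) ≠ 0 := by exact_mod_cast hε.ne'
  have hpow : (ε : ℂ) ^ (-(n : ℂ) ^ 2 - α * n) * (ε : ℂ) ^ ((n : ℂ) ^ 2 + α * n) = 1 := by
    rw [← Complex.cpow_add _ _ hε0]
    ring_nf
    exact Complex.cpow_zero _
  have hinv : (1 / ((1 / ε : ℝ) : ℂ)) = ε := by
    push_cast
    field_simp
  have hpi : (Real.pi : ℂ) ^ (n * (n - 1) / 2) ≠ 0 :=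
    pow_ne_zero _ (by exact_mod_cast Real.pi_ne_zero)
  simp only [expect, mul_one]
  rw [integral_laguerreWeight n hα (one_div_pos.mpr hε), hinv, partitionConst,
    show (n : ℂ) + α + 1 = α + 1 + n by ring]
  rw [div_mul_eq_mul_div, div_eq_one_iff_eq (mul_ne_zero hpi hG2), hG]
  linear_combination barnesG (α + 1) * (Real.pi : ℂ) ^ (n * (n - 1) / 2) *
    (∏ j ∈ Finset.range n, Complex.Gamma (α + 1 + j)) * hpow

theorem expect_add {α : ℂ} (hα : -1 < α.re) {ε : ℝ} (hε : 0 < ε)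
    {P Q : Matrix (Fin n) (Fin n) ℂ → ℂ} (hP : Tame P) (hQ : Tame Q) :
    expect α ε (fun M => P M + Q M) = expect α ε P + expect α ε Q := by
  have hc := one_div_pos.mpr hε
  simp only [expect, mul_add]
  rw [integral_add (hP.integrableOn_mul hα hc) (hQ.integrableOn_mul hα hc), mul_add]

theorem expect_sum {α : ℂ} (hα : -1 < α.re) {ε : ℝ} (hε : 0 < ε) {ι : Type*} (S : Finset ι)
    {f : ι → Matrix (Fin n) (Fin n) ℂ → ℂ} (hf : ∀ i ∈ S, Tame (f i)) :
    expect α ε (fun M => ∑ i ∈ S, f i M) = ∑ i ∈ S, expect α ε (f i) := by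
  have hc := one_div_pos.mpr hε
  simp only [expect, Finset.mul_sum]
  rw [integral_finsetSum _ fun i hi => (hf i hi).integrableOn_mul hα hc, Finset.mul_sum]

/-- The variable `t_j = tr (M ^ j) / (j ε)` dual to `p_j`. -/
noncomputable def time (ε : ℝ) (j : ℕ+) (M : Matrix (Fin n) (Fin n) ℂ) : ℂ :=
  (M ^ (j : ℕ)).trace / ((j : ℂ) * (ε : ℂ))

theorem tame_time (ε : ℝ) (j : ℕ+) : Tame (time ε j : Matrix (Fin n) (Fin n) ℂ → ℂ) := by
  unfold time
  simp only [div_eq_mul_inv]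
  exact (tame_trace (tame_pow_entry _)).mul (tame_const _)

theorem trace_pow_eq {ε : ℝ} (hε : 0 < ε) (j : ℕ+) (M : Matrix (Fin n) (Fin n) ℂ) :
    (M ^ (j : ℕ)).trace = j * ε * time ε j M := by
  have h1 : (ε : ℂ) ≠ 0 := by exact_mod_cast hε.ne'
  have h2 : (j : ℂ) ≠ 0 := by exact_mod_cast j.ne_zero
  rw [time]
  field_simp

theorem coeff_dP_partitionFunction (α : ℂ) (ε : ℝ) (j : ℕ+) (μ : ℕ+ →₀ ℕ) :
    MvPowerSeries.coeff μ (dP j (partitionFunction n α ε)) =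
      expect α ε fun M : Matrix (Fin n) (Fin n) ℂ => time ε j M * timePoly ε μ M := by
  rw [coeff_dP, coeff_partitionFunction, mul_comm, ← expect_const_mul]
  congr 1
  ext M
  rw [mul_comm, timePoly_add_single]
  rfl

theorem coeff_dP_dP_partitionFunction (α : ℂ) (ε : ℝ) (i j : ℕ+) (μ : ℕ+ →₀ ℕ) :
    MvPowerSeries.coeff μ (dP i (dP j (partitionFunction n α ε))) =
      expect α ε fun M : Matrix (Fin n) (Fin n) ℂ =>
        time ε i M * time ε j M * timePoly ε μ M := by
  rw [coeff_dP, coeff_dP_partitionFunction, mul_comm, ← expect_const_mul]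
  congr 1
  ext M
  rw [mul_left_comm, mul_comm ((μ i : ℂ) + 1), timePoly_add_single, time, time]
  ring

/-- The derivative of the coefficients of `exp (∑ p_j t_j)` along `M ^ k` is the action of
`∑ j, p_j (j + k - 1) ∂/∂p_{j+k-1}`. -/
theorem coeff_opSum_shiftTerm {α : ℂ} (hα : -1 < α.re) {ε : ℝ} (hε : 0 < ε) (k : ℕ+)
    (μ : ℕ+ →₀ ℕ) :
    MvPowerSeries.coeff μ (opSum _ (shiftTerm_locallyFinite k) (partitionFunction n α ε)) =
      expect α ε fun M : Matrix (Fin n) (Fin n) ℂ => timePolyDeriv ε μ M (M ^ (k : ℕ)) := by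
  rw [coeff_opSum, finsum_eq_sum_of_support_subset (s := μ.support)]
  · simp only [timePolyDeriv_apply]
    have hcoe (j : ℕ+) : ((k + j - 1 : ℕ+) : ℕ) = (j : ℕ) - 1 + k := by
      have := coe_add_sub_one k j
      have := j.pos
      omega
    rw [expect_sum hα hε]
    · refine Finset.sum_congr rfl fun j hj => ?_
      have hμ : μ j ≠ 0 := Finsupp.mem_support_iff.mp hj
      simp only [shiftTerm, LinearMap.smul_apply, map_smul, Module.End.mul_apply, coeff_mulP, hμ,
        if_false, smul_eq_mul]
      rw [coeff_dP_partitionFunction, ← expect_const_mul]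
      congr 1
      ext M
      have h1 : (ε : ℂ) ≠ 0 := by exact_mod_cast hε.ne'
      rw [← pow_add, ← hcoe, trace_pow_eq hε]
      field_simp
    · intro j _
      simp only [div_eq_mul_inv]
      exact ((tame_timePoly ε _).mul (tame_const _)).mul
        (tame_trace (tame_mul_entry (tame_pow_entry _) (tame_pow_entry _)))
  · intro j hj
    rw [Finset.mem_coe, Finsupp.mem_support_iff]
    intro h
    exact hj (by simp [shiftTerm, coeff_mulP, h])

theorem sum_range_succ_eq_sum_pairs (m : ℕ+) (f : ℕ → ℕ → ℂ) :
    ∑ a ∈ Finset.range ((m : ℕ) + 1), f a (m - a) =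
      f 0 m + f m 0 + ∑ q ∈ pairsWithSum m, f q.1 q.2 := by
  obtain ⟨k, hk⟩ := Nat.exists_eq_succ_of_ne_zero m.ne_zero
  have h : ∑ a ∈ Finset.range (m : ℕ), f a (m - a) =
      f 0 m + ∑ q ∈ pairsWithSum m, f q.1 q.2 := by
    rw [hk, Nat.succ_eq_add_one, Finset.sum_range_succ', Nat.sub_zero, add_comm]
    congr 1
    refine Finset.sum_bij' (fun a ha => (⟨a + 1, by omega⟩, ⟨k - a, by
      have := Finset.mem_range.mp ha; omega⟩)) (fun q _ => (q.1 : ℕ) - 1) ?_ ?_ ?_ ?_ ?_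
    · intro a ha
      have := Finset.mem_range.mp ha
      rw [mem_pairsWithSum]
      apply PNat.eq
      change a + 1 + (k - a) = m
      omega
    · intro q hq
      have h1 := congrArg PNat.val (mem_pairsWithSum.mp hq)
      have h2 := q.1.pos
      have h3 := q.2.pos
      rw [Finset.mem_range]
      simp only [PNat.add_coe] at h1
      omega
    · intro a ha
      simp
    · intro q hq
      have h1 := congrArg PNat.val (mem_pairsWithSum.mp hq)
      have h2 := q.1.pos
      have h3 := q.2.pos
      simp only [PNat.add_coe] at h1
      refine Prod.ext (PNat.eq ?_) (PNat.eq ?_) <;> simp only [PNat.mk_coe] <;> omega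
    · intro a ha
      simp
  rw [Finset.sum_range_succ, Nat.sub_self, h]
  ring

/-- The Virasoro constraint of index `0`: the loop equation for the vector field `M ↦ M`,
with `t_j` under the integral replaced by `∂/∂p_j`. -/
theorem virasoro_one {α : ℂ} (hα : -1 < α.re) {ε : ℝ} (hε : 0 < ε) :
    dP 1 (partitionFunction n α ε) = ((n : ℂ) * (n + α)) • partitionFunction n α ε +
      opSum _ (shiftTerm_locallyFinite 1) (partitionFunction n α ε) := by
  ext μ
  have hc := one_div_pos.mpr hε
  have hε0 : (ε : ℂ) ≠ 0 := by exact_mod_cast hε.ne'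
  have hloop := integral_loopIntegrand (n := n) hα hc ε 0 μ
  have hexp : expect α ε (loopIntegrand α (1 / ε) ε 0 μ : Matrix (Fin n) (Fin n) ℂ → ℂ) = 0 := by
    rw [expect, hloop, mul_zero]
  have hpt : (loopIntegrand α (1 / ε) ε 0 μ : Matrix (Fin n) (Fin n) ℂ → ℂ) = fun M =>
      ((n : ℂ) * (n + α)) * timePoly ε μ M + timePolyDeriv ε μ M (M ^ ((1 : ℕ+) : ℕ)) +
        (-1) * (time ε 1 M * timePoly ε μ M) := by
    ext M
    have h1 := trace_pow_eq hε 1 M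
    simp only [loopIntegrand, PNat.one_coe, Nat.cast_one, one_mul, zero_add, pow_zero,
      Matrix.trace_one, Fintype.card_fin, Finset.range_one, Finset.sum_singleton,
      Nat.sub_self] at h1 ⊢
    rw [h1]
    push_cast
    field_simp
    ring
  have hd : Tame fun M : Matrix (Fin n) (Fin n) ℂ =>
      timePolyDeriv ε μ M (M ^ ((1 : ℕ+) : ℕ)) := tame_timePolyDeriv_pow ε μ _
  rw [hpt, expect_add hα hε (((tame_const _).mul (tame_timePoly ε μ)).add hd)
    ((tame_const _).mul ((tame_time ε 1).mul (tame_timePoly ε μ))),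
    expect_add hα hε ((tame_const _).mul (tame_timePoly ε μ)) hd,
    expect_const_mul, expect_const_mul, ← coeff_partitionFunction, ← coeff_dP_partitionFunction,
    ← coeff_opSum_shiftTerm hα hε] at hexp
  rw [map_add, map_smul, smul_eq_mul]
  linear_combination -hexp

/-- The Virasoro constraint of index `m`: the loop equation for the vector field
`M ↦ M ^ (m + 1)`. The products of two traces become second derivatives, apart from the two
extreme ones, which contain `tr 1 = n`. -/
theorem virasoro_succ {α : ℂ} (hα : -1 < α.re) {ε : ℝ} (hε : 0 < ε) (m : ℕ+) :
    ((m : ℂ) + 1) • dP (m + 1) (partitionFunction n α ε) =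
      ((2 * n + α) * ε * m) • dP m (partitionFunction n α ε) +
      (ε : ℂ) ^ 2 • ∑ q ∈ pairsWithSum m,
        ((q.1 : ℂ) * (q.2 : ℂ)) • dP q.1 (dP q.2 (partitionFunction n α ε)) +
      opSum _ (shiftTerm_locallyFinite (m + 1)) (partitionFunction n α ε) := by
  ext μ
  have hc := one_div_pos.mpr hε
  have hε0 : (ε : ℂ) ≠ 0 := by exact_mod_cast hε.ne'
  have hloop := integral_loopIntegrand (n := n) hα hc ε m μ
  have hexp : expect α ε (loopIntegrand α (1 / ε) ε m μ : Matrix (Fin n) (Fin n) ℂ → ℂ) = 0 := by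
    rw [expect, hloop, mul_zero]
  have hpt : (loopIntegrand α (1 / ε) ε m μ : Matrix (Fin n) (Fin n) ℂ → ℂ) = fun M =>
      ((2 * n + α) * ε * m) * (time ε m M * timePoly ε μ M) +
        (∑ q ∈ pairsWithSum m, (ε : ℂ) ^ 2 * ((q.1 : ℂ) * (q.2 : ℂ)) *
          (time ε q.1 M * time ε q.2 M * timePoly ε μ M)) +
        timePolyDeriv ε μ M (M ^ ((m + 1 : ℕ+) : ℕ)) +
        (-(m + 1)) * (time ε (m + 1) M * timePoly ε μ M) := by
    ext M
    have h1 := trace_pow_eq hε (m + 1) M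
    rw [PNat.add_coe, PNat.one_coe] at h1
    have hs : ∑ q ∈ pairsWithSum m, (ε : ℂ) ^ 2 * ((q.1 : ℂ) * (q.2 : ℂ)) *
        (time ε q.1 M * time ε q.2 M * timePoly ε μ M) =
        timePoly ε μ M * ∑ q ∈ pairsWithSum m, (M ^ (q.1 : ℕ)).trace * (M ^ (q.2 : ℕ)).trace := by
      rw [Finset.mul_sum]
      refine Finset.sum_congr rfl fun q _ => ?_
      rw [trace_pow_eq hε, trace_pow_eq hε]
      ring
    rw [hs, loopIntegrand,
      sum_range_succ_eq_sum_pairs m fun a b => (M ^ a).trace * (M ^ b).trace, h1,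
      trace_pow_eq hε m]
    simp only [pow_zero, Matrix.trace_one, Fintype.card_fin, PNat.add_coe, PNat.one_coe]
    push_cast
    field_simp
    ring
  have hT := tame_timePoly (n := n) ε μ
  have hd : Tame fun M : Matrix (Fin n) (Fin n) ℂ =>
      timePolyDeriv ε μ M (M ^ ((m + 1 : ℕ+) : ℕ)) := tame_timePolyDeriv_pow ε μ _
  have hq : Tame fun M : Matrix (Fin n) (Fin n) ℂ =>
      ∑ q ∈ pairsWithSum m, (ε : ℂ) ^ 2 * ((q.1 : ℂ) * (q.2 : ℂ)) *
          (time ε q.1 M * time ε q.2 M * timePoly ε μ M) :=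
    Tame.sum _ fun q _ => (tame_const _).mul (((tame_time ε q.1).mul (tame_time ε q.2)).mul hT)
  have hm : Tame fun M : Matrix (Fin n) (Fin n) ℂ =>
      ((2 * n + α) * ε * m) * (time ε m M * timePoly ε μ M) :=
    (tame_const _).mul ((tame_time ε m).mul hT)
  rw [hpt, expect_add hα hε ((hm.add hq).add hd)
    ((tame_const _).mul ((tame_time ε (m + 1)).mul hT)), expect_add hα hε (hm.add hq) hd,
    expect_add hα hε hm hq, expect_sum hα hε _ fun q _ =>
      (tame_const _).mul (((tame_time ε q.1).mul (tame_time ε q.2)).mul hT)] at hexp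
  simp only [expect_const_mul, ← coeff_dP_partitionFunction, ← coeff_dP_dP_partitionFunction,
    ← coeff_opSum_shiftTerm hα hε] at hexp
  simp only [map_add, map_smul, map_sum, smul_eq_mul, Finset.mul_sum]
  simp only [mul_assoc] at hexp ⊢
  linear_combination -hexp

end Virasoro

end LUE

theorem mainTheorem6 (n : ℕ) (ε : ℝ) (hε : 0 < ε) (x a : ℂ) (hx : x = n * (ε : ℂ))
    (ha : -1 < (a / (ε : ℂ)).re) :
    (∀ μ : ℕ+ →₀ ℕ, MeasureTheory.IntegrableOn
      (fun c : LUE.HermCoord n => LUE.taylorCoeff (a / (ε : ℂ)) ε μ (LUE.hermOf c))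
      (LUE.posCone n)) ∧
    HasSum (fun k : ℕ => ((k ! : ℂ)⁻¹) • ((LUE.WLaguerre x a ε) ^ k) (1 : LUE.PSeries))
      (LUE.partitionFunction n (a / (ε : ℂ)) ε) := by
  have hε0 : (ε : ℂ) ≠ 0 := by exact_mod_cast hε.ne'
  refine ⟨fun μ => ?_, LUE.hasSum_exp_WLaguerre ?_ (LUE.wt_mul_coeff_eq_of_virasoro ?_ fun m => ?_)⟩
  · simp only [LUE.taylorCoeff_eq]
    exact (LUE.tame_timePoly ε μ).integrableOn_mul ha (one_div_pos.mpr hε)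
  · rw [LUE.coeff_partitionFunction, ← LUE.expect_one (n := n) ha hε]
    exact congrArg _ (funext fun M => LUE.timePoly_zero ε M)
  · have h : x * (x + a) / (ε : ℂ) ^ 2 = (n : ℂ) * (n + a / ε) := by
      rw [hx]
      field_simp
    rw [h]
    exact LUE.virasoro_one ha hε
  · have h : 2 * x + a = (2 * n + a / ε) * ε := by
      rw [hx]
      field_simp
    rw [h]
    exact LUE.virasoro_succ ha hε m
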